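/- Definitions. For a countable set $V\subseteq[0,1]$ let $\langle V\rangle$ be the intersection with $[0,1]$ of the subgroup of $(\mathbb R,+)$ generated by $V\cup\{1\}$. Call $V$ group-like if $V=\langle V\rangle$ and $V\not\subseteq\frac1p\mathbb Z$ for every nonzero integer $p$, and $\mathbb Q$-like if it is group-like and $V+\mathbb Z$ is a $\mathbb Q$-vector subspace of $\mathbb R$. A finite $V$-valued probability algebra is a finite Boolean algebra with a finitely additive measure $\mu$ with values in $V$ such that $\mu(1)=1$ and $\mu(a)>0$ for $a\neq0$. Let $\mathcal K^V_{\mathrm{aut}}$ be the class of pairs $(A,\varphi)$ where $A$ is a finite $V$-valued probability algebra and $\varphi$ is a measure-preserving automorphism of $A$; an embedding $(A,\varphi)\to(B,\psi)$ is an injective measure-preserving homomorphism of Boolean algebras $\alpha$ with $\psi\circ\alpha=\alpha\circ\varphi$. It has the amalgamation property if for all embeddings $i:\mathbf A\to\mathbf B$, $j:\mathbf A\to\mathbf C$ in the class there are $\mathbf D$ in the class and embeddings $\beta:\mathbf B\to\mathbf D$, $\gamma:\mathbf C\to\mathbf D$ with $\beta\circ i=\gamma\circ j$. A good measure on a Cantor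 space $X$ (a nonempty, zero-dimensional, perfect, compact metrizable space) is an atomless Borel probability measure $\mu$ of full support such that whenever $A,B\subseteq X$ are clopen and $\mu(A)\le\mu(B)$ there is a clopen $C\subseteq B$ with $\mu(C)=\mu(A)$; its clopen value set is $V(\mu)=\{\mu(A): A\subseteq X\text{ clopen}\}$. Let $H_\mu$ be the group of all homeomorphisms of $X$ preserving $\mu$, with the topology generated by the sets $\{g\in H_\mu: g(U)=W\}$, $U,W\subseteq X$ clopen. Proposition. Let $V\subseteq[0,1]$ be a group-like set. Then $V$ is $\mathbb Q$-like if and only if $\mathcal K^V_{\mathrm{aut}}$ has the amalgamation property. Moreover, if $V$ is $\mathbb Q$-like, then for every good measure $\mu$ on a Cantor space $X$ with $V(\mu)=V$, the group $H_\mu$ has a comeager conjugacy class. -/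

import Mathlib

open Set MeasureTheory Topology
open scoped Pointwise

universe u v

/-- For a set `V` of reals, `⟨V⟩`: the intersection with `[0, 1]` of the additive subgroup of `ℝ`
generated by `V ∪ {1}`. -/
def valueSpan (V : Set ℝ) : Set ℝ :=
  (AddSubgroup.closure (V ∪ {1}) : Set ℝ) ∩ Icc 0 1

/-- A countable set `V ⊆ [0, 1]` is group-like if `V = ⟨V⟩` and `V` is not contained in
`(1 / p) ℤ` for any nonzero integer `p`. -/
structure GroupLikeSet (V : Set ℝ) : Prop where
  countable : V.Countable
  subset_Icc : V ⊆ Icc 0 1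
  not_subset : ∀ p : ℤ, p ≠ 0 → ¬ V ⊆ {x : ℝ | ∃ k : ℤ, x = k / p}
  eq_span : V = valueSpan V

/-- A group-like set `V` is `ℚ`-like if `V + ℤ` is a `ℚ`-vector subspace of `ℝ`. -/
def QLikeSet (V : Set ℝ) : Prop :=
  GroupLikeSet V ∧ ∃ W : Submodule ℚ ℝ, (W : Set ℝ) = V + range (fun k : ℤ => (k : ℝ))

/-- A finite probability algebra with values in `V`: a finite Boolean algebra with a strictly
positive, finitely additive probability measure all of whose values lie in `V`. -/
structure FinProbAlg (V : Set ℝ) where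
  /-- the underlying Boolean algebra -/
  carrier : Type u
  [boolAlg : BooleanAlgebra carrier]
  [fin : Finite carrier]
  /-- the measure -/
  meas : carrier → ℝ
  meas_mem : ∀ a, meas a ∈ V
  meas_top : meas ⊤ = 1
  meas_sup : ∀ a b, Disjoint a b → meas (a ⊔ b) = meas a + meas b
  meas_pos : ∀ a, a ≠ ⊥ → 0 < meas a

attribute [instance] FinProbAlg.boolAlg FinProbAlg.fin

/-- The class of finite `V`-valued probability algebras together with a global
(measure-preserving) automorphism. -/
structure FinProbAlgAut (V : Set ℝ) extends FinProbAlg.{u} V where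
  /-- the automorphism -/
  aut : carrier ≃o carrier
  meas_aut : ∀ a, meas (aut a) = meas a

/-- Embeddings of finite `V`-valued probability algebras with automorphism: injective
homomorphisms of Boolean algebras that preserve the measure and intertwine the automorphisms. -/
structure FinProbAlgAut.Emb {V : Set ℝ} (A B : FinProbAlgAut.{u} V) where
  /-- the underlying homomorphism of Boolean algebras -/
  toHom : BoundedLatticeHom A.carrier B.carrier
  injective : Function.Injective toHom
  meas_map : ∀ a, B.meas (toHom a) = A.meas a
  map_aut : ∀ a, toHom (A.aut a) = B.aut (toHom a)

/-- The amalgamation property of the class of finite `V`-valued probability algebras with a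
global automorphism. -/
def AutAmalgamation (V : Set ℝ) : Prop :=
  ∀ (A B C : FinProbAlgAut.{u} V) (i : A.Emb B) (j : A.Emb C),
    ∃ (D : FinProbAlgAut.{u} V) (β : B.Emb D) (γ : C.Emb D),
      ∀ a, β.toHom (i.toHom a) = γ.toHom (j.toHom a)

/-- The topology on `Homeo(X)` generated by the sets `{g | g(U) = W}` with `U`, `W` clopen. -/
instance homeoTopology (X : Type v) [TopologicalSpace X] : TopologicalSpace (X ≃ₜ X) :=
  TopologicalSpace.generateFrom
    {S | ∃ U W : Set X, IsClopen U ∧ IsClopen W ∧ S = {g : X ≃ₜ X | g '' U = W}}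

section Measure

variable {X : Type v} [TopologicalSpace X] [MeasurableSpace X]

/-- Good measures: atomless Borel probability measures of full support such that, for clopen
`A`, `B` with `μ(A) ≤ μ(B)`, there is a clopen `C ⊆ B` with `μ(C) = μ(A)`. -/
structure IsGoodMeasure (μ : Measure X) : Prop where
  prob : IsProbabilityMeasure μ
  null_singleton : NullSingletonClass μ
  fullSupport : μ.IsOpenPosMeasure
  good : ∀ A B : Set X, IsClopen A → IsClopen B → μ A ≤ μ B →
    ∃ C : Set X, IsClopen C ∧ C ⊆ B ∧ μ C = μ A

/-- The clopen value set `V(μ)`. -/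
def clopenValueSet (μ : Measure X) : Set ℝ :=
  {r | ∃ A : Set X, IsClopen A ∧ (μ A).toReal = r}

/-- The group `H_μ` of all homeomorphisms of `X` which preserve `μ`; as a subgroup of `Homeo(X)`
it carries the subspace topology. -/
def homeoPreserving [BorelSpace X] (μ : Measure X) : Subgroup (X ≃ₜ X) where
  carrier := {g | MeasurePreserving g μ μ}
  mul_mem' := fun ha hb => ha.comp hb
  one_mem' := MeasurePreserving.id μ
  inv_mem' := fun {g} hg => MeasurePreserving.symm g.toMeasurableEquiv hg

end Measure

/-- A topological group has a comeager conjugacy class. -/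
def HasComeagerConjClass (G : Type v) [Group G] [TopologicalSpace G] : Prop :=
  ∃ g : G, conjugatesOf g ∈ residual G

/-! ### Couplings and circulations with entries in a subgroup of the reals. -/

section Combinatorics

variable {α β γ ι κ : Type*}

/-! Let `G` be the subgroup generated by `V ∪ {1}`. For group-like `V` it equals `V + ℤ` and is
dense in `ℝ`, and `V` is `ℚ`-like exactly when `G` is divisible (`GroupLikeSet.qLikeSet_iff`).

Finite algebras with automorphism are dual to finite weighted sets with a weight-preserving
permutation. An amalgam corresponds to an invariant `G`-valued coupling supported on the fibred
product. A coupling exists over any `G`; averaging it over the joint period of the two permutations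
makes it invariant, and only this division needs divisibility (`exists_invariant_coupling`).
Conversely, amalgamate an event of mass `x` fixed by the automorphism with a cycle of `n` atoms
whose union contains it: the event meets each atom in mass `x / n`, so `x / n ∈ G`
(`exists_smul_of_autAmalgamation`).

For the comeager class, call a homeomorphism generic if its finite factors refine every clopen
partition and every finite extension of such a factor is realised (`IsGenericHomeo`). These are
countably many open conditions, since `V` and the clopen algebra are countable. The first is dense
because a balanced matrix decomposes into cycles (`exists_perm_of_balanced`); the second is dense by
invariant couplings, hence by divisibility. Generic homeomorphisms are pairwise conjugate by
back-and-forth, and they exist because `H_μ` is Baire. -/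

/-- Greedy filling: each slot takes the minimum of its capacity and what is left. A minimum is one
of its two arguments, so it never leaves `G`. -/
theorem exists_bounded_summands (G : AddSubgroup ℝ) (s : Finset κ) (c : κ → ℝ)
    (hc : ∀ k, 0 ≤ c k) (hcG : ∀ k, c k ∈ G) (r : ℝ) (hr : 0 ≤ r) (hrG : r ∈ G)
    (hle : r ≤ ∑ k ∈ s, c k) :
    ∃ x : κ → ℝ, (∀ k, x k ∈ G) ∧ (∀ k, 0 ≤ x k) ∧ (∀ k, x k ≤ c k) ∧ ∑ k ∈ s, x k = r := by
  classical
  induction s using Finset.induction_on generalizing r with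
  | empty =>
    refine ⟨fun _ => 0, fun _ => G.zero_mem, fun _ => le_rfl, hc, ?_⟩
    simp at hle ⊢
    linarith
  | insert a s ha ih =>
    rw [Finset.sum_insert ha] at hle
    have hmin : min r (c a) ∈ G := by
      rcases min_choice r (c a) with h | h <;> rw [h]
      exacts [hrG, hcG a]
    obtain ⟨x, hxG, hx0, hxc, hx⟩ := ih (r - min r (c a)) (by simp) (G.sub_mem hrG hmin) (by
      rcases min_choice r (c a) with h | h <;> rw [h]
      · simpa using Finset.sum_nonneg fun k _ => hc k
      · linarith)
    refine ⟨Function.update x a (min r (c a)), fun k => ?_, fun k => ?_, fun k => ?_, ?_⟩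
    · by_cases h : k = a
      · subst h; simpa using hmin
      · simpa [h] using hxG k
    · by_cases h : k = a
      · subst h; simpa using ⟨hr, hc k⟩
      · simpa [h] using hx0 k
    · by_cases h : k = a
      · subst h; simp
      · simpa [h] using hxc k
    · rw [Finset.sum_insert ha, Function.update_self]
      have : ∑ k ∈ s, Function.update x a (min r (c a)) k = ∑ k ∈ s, x k :=
        Finset.sum_congr rfl fun k hk => by
          rw [Function.update_of_ne]
          rintro rfl
          exact ha hk
      rw [this, hx]
      ring

/-- The transportation problem over a subgroup of the reals. -/
theorem exists_coupling_finset (G : AddSubgroup ℝ) (s : Finset ι) (t : Finset κ)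
    (r : ι → ℝ) (c : κ → ℝ) (hr : ∀ i, 0 ≤ r i) (hrG : ∀ i, r i ∈ G)
    (hc : ∀ k, 0 ≤ c k) (hcG : ∀ k, c k ∈ G) (h : ∑ i ∈ s, r i = ∑ k ∈ t, c k) :
    ∃ W : ι → κ → ℝ, (∀ i k, W i k ∈ G) ∧ (∀ i k, 0 ≤ W i k) ∧
      (∀ i ∈ s, ∑ k ∈ t, W i k = r i) ∧ ∀ k ∈ t, ∑ i ∈ s, W i k = c k := by
  classical
  induction s using Finset.induction_on generalizing c with
  | empty =>
    refine ⟨fun _ _ => 0, fun _ _ => G.zero_mem, fun _ _ => le_rfl, by simp, fun k hk => ?_⟩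
    rw [Finset.sum_empty] at h ⊢
    exact ((Finset.sum_eq_zero_iff_of_nonneg fun k _ => hc k).1 h.symm k hk).symm
  | insert a s ha ih =>
    rw [Finset.sum_insert ha] at h
    have hs : 0 ≤ ∑ i ∈ s, r i := Finset.sum_nonneg fun i _ => hr i
    -- Row `a` is served first; the other rows share the residual capacities `c k - x k`.
    obtain ⟨x, hxG, hx0, hxc, hx⟩ :=
      exists_bounded_summands G t c hc hcG (r a) (hr a) (hrG a) (by linarith)
    obtain ⟨W, hWG, hW0, hWr, hWc⟩ := ih (fun k => c k - x k) (fun k => sub_nonneg.2 (hxc k))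
      (fun k => G.sub_mem (hcG k) (hxG k)) (by rw [Finset.sum_sub_distrib]; linarith)
    have hne : ∀ i ∈ s, i ≠ a := by
      rintro i hi rfl
      exact ha hi
    refine ⟨Function.update W a x, fun i k => ?_, fun i k => ?_, fun i hi => ?_, fun k hk => ?_⟩
    · by_cases h : i = a
      · subst h; simpa using hxG k
      · simpa [h] using hWG i k
    · by_cases h : i = a
      · subst h; simpa using hx0 k
      · simpa [h] using hW0 i k
    · rcases Finset.mem_insert.1 hi with rfl | hi
      · simpa using hx
      · simpa [hne i hi] using hWr i hi
    · rw [Finset.sum_insert ha, Function.update_self,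
        Finset.sum_congr rfl fun i hi => by rw [Function.update_of_ne (hne i hi)], hWc k hk]
      ring

open Classical in
/-- The pushforward along `f` of a weight function. -/
noncomputable def pushWeight [Fintype κ] (f : κ → ι) (w : κ → ℝ) (i : ι) : ℝ :=
  ∑ k, if f k = i then w k else 0

theorem pushWeight_sumElim [Fintype β] [Fintype γ] (f : β → ι) (g : γ → ι) (w : β → ℝ)
    (v : γ → ℝ) (i : ι) :
    pushWeight (Sum.elim f g) (Sum.elim w v) i = pushWeight f w i + pushWeight g v i := by
  unfold pushWeight
  rw [Fintype.sum_sum_type]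
  rfl

/-- Over each point of `α` the two fibres have equal total weight, so the transportation problem is
solved fibre by fibre and extended by zero. -/
theorem exists_fibred_coupling [Fintype β] [Fintype γ] (G : AddSubgroup ℝ)
    (f : β → α) (g : γ → α) (r : β → ℝ) (c : γ → ℝ) (hr : ∀ i, 0 ≤ r i) (hrG : ∀ i, r i ∈ G)
    (hc : ∀ k, 0 ≤ c k) (hcG : ∀ k, c k ∈ G) (h : pushWeight f r = pushWeight g c) :
    ∃ W : β × γ → ℝ, (∀ p, W p ∈ G) ∧ (∀ p, 0 ≤ W p) ∧ (∀ p, W p ≠ 0 → f p.1 = g p.2) ∧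
      (∀ b, ∑ k, W (b, k) = r b) ∧ ∀ k, ∑ b, W (b, k) = c k := by
  classical
  have key : ∀ a, ∃ W : β → γ → ℝ, (∀ i k, W i k ∈ G) ∧ (∀ i k, 0 ≤ W i k) ∧
      (∀ i, f i = a → ∑ k with g k = a, W i k = r i) ∧
      ∀ k, g k = a → ∑ i with f i = a, W i k = c k := fun a => by
    obtain ⟨W, h1, h2, h3, h4⟩ := exists_coupling_finset G (Finset.univ.filter fun b => f b = a)
      (Finset.univ.filter fun k => g k = a) r c hr hrG hc hcG (by
        have := congrFun h a
        simpa only [pushWeight, ← Finset.sum_filter] using this)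
    exact ⟨W, h1, h2, fun i hi => h3 i (by simp [hi]), fun k hk => h4 k (by simp [hk])⟩
  choose W h1 h2 h3 h4 using key
  refine ⟨fun p => if f p.1 = g p.2 then W (f p.1) p.1 p.2 else 0, fun p => ?_, fun p => ?_,
    fun p hp => ?_, fun b => ?_, fun k => ?_⟩
  · dsimp only
    split_ifs
    exacts [h1 _ _ _, G.zero_mem]
  · dsimp only
    split_ifs
    exacts [h2 _ _ _, le_rfl]
  · by_contra hne
    exact hp (if_neg hne)
  · rw [← h3 (f b) b rfl, Finset.sum_filter]
    exact Finset.sum_congr rfl fun k _ => by simp [eq_comm]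
  · rw [← h4 (g k) k rfl, Finset.sum_filter]
    refine Finset.sum_congr rfl fun b _ => ?_
    dsimp only
    split_ifs with hb
    exacts [by rw [hb], rfl]

/-- Over a divisible subgroup of the reals, weights on two finite dynamical systems with a common
factor admit an invariant coupling which is supported on the fibred product. -/
theorem exists_invariant_coupling [Fintype β] [Fintype γ] (G : AddSubgroup ℝ)
    (hG : ∀ x ∈ G, ∀ n : ℕ, n ≠ 0 → x / n ∈ G)
    (f : β → α) (g : γ → α) (r : β → ℝ) (c : γ → ℝ) (hr : ∀ i, 0 ≤ r i) (hrG : ∀ i, r i ∈ G)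
    (hc : ∀ k, 0 ≤ c k) (hcG : ∀ k, c k ∈ G) (h : pushWeight f r = pushWeight g c)
    (σ : Equiv.Perm α) (ρ : Equiv.Perm β) (τ : Equiv.Perm γ) (hf : ∀ b, f (ρ b) = σ (f b))
    (hg : ∀ k, g (τ k) = σ (g k)) (hρ : ∀ b, r (ρ b) = r b) (hτ : ∀ k, c (τ k) = c k) :
    ∃ W : β × γ → ℝ, (∀ p, W p ∈ G) ∧ (∀ p, 0 ≤ W p) ∧ (∀ p, W p ≠ 0 → f p.1 = g p.2) ∧
      (∀ p : β × γ, W (ρ p.1, τ p.2) = W p) ∧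
      (∀ b, ∑ k, W (b, k) = r b) ∧ ∀ k, ∑ b, W (b, k) = c k := by
  classical
  obtain ⟨W, hWG, hW0, hWs, hWr, hWc⟩ := exists_fibred_coupling G f g r c hr hrG hc hcG h
  -- A common period of `ρ` and `τ`; averaging over `N` steps is averaging over the orbit of the
  -- pair.
  set N := orderOf ρ * orderOf τ with hN
  have hN0 : N ≠ 0 := (Nat.mul_pos (orderOf_pos ρ) (orderOf_pos τ)).ne'
  have hN0' : (N : ℝ) ≠ 0 := Nat.cast_ne_zero.2 hN0
  have hρN : ρ ^ N = 1 := by rw [hN, pow_mul, pow_orderOf_eq_one, one_pow]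
  have hτN : τ ^ N = 1 := by rw [hN, mul_comm, pow_mul, pow_orderOf_eq_one, one_pow]
  have hρk : ∀ k b, r ((ρ ^ k) b) = r b := fun k => by
    induction k with
    | zero => simp
    | succ k ih => intro b; rw [pow_succ', Equiv.Perm.mul_apply, hρ, ih]
  have hτk : ∀ k b, c ((τ ^ k) b) = c b := fun k => by
    induction k with
    | zero => simp
    | succ k ih => intro b; rw [pow_succ', Equiv.Perm.mul_apply, hτ, ih]
  have hfk : ∀ k b, f ((ρ ^ k) b) = (σ ^ k) (f b) := fun k => by
    induction k with
    | zero => simp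
    | succ k ih => intro b; rw [pow_succ', Equiv.Perm.mul_apply, hf, ih, pow_succ']; rfl
  have hgk : ∀ k b, g ((τ ^ k) b) = (σ ^ k) (g b) := fun k => by
    induction k with
    | zero => simp
    | succ k ih => intro b; rw [pow_succ', Equiv.Perm.mul_apply, hg, ih, pow_succ']; rfl
  refine ⟨fun p => (∑ k ∈ Finset.range N, W ((ρ ^ k) p.1, (τ ^ k) p.2)) / N, fun p => ?_,
    fun p => ?_, fun p hp => ?_, fun p => ?_, fun b => ?_, fun x => ?_⟩
  · exact hG _ (G.sum_mem fun k _ => hWG _) N hN0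
  · exact div_nonneg (Finset.sum_nonneg fun k _ => hW0 _) (Nat.cast_nonneg N)
  · obtain ⟨k, -, hk⟩ := Finset.exists_ne_zero_of_sum_ne_zero fun h0 => hp (by
      dsimp only
      rw [h0, zero_div])
    have := hWs _ hk
    dsimp only at this
    rw [hfk, hgk] at this
    exact (σ ^ k).injective this
  · dsimp only
    congr 1
    -- Shifting the sum by one step trades the term at `0` for the term at `N`, and these coincide.
    have h1 := Finset.sum_range_succ (fun k => W ((ρ ^ k) p.1, (τ ^ k) p.2)) N
    rw [Finset.sum_range_succ', hρN, hτN] at h1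
    simp only [pow_zero] at h1
    rw [← add_right_cancel h1]
    refine Finset.sum_congr rfl fun k _ => ?_
    rw [pow_succ, pow_succ]
    rfl
  · rw [← Finset.sum_div, Finset.sum_comm, div_eq_iff hN0']
    rw [Finset.sum_congr rfl fun k _ =>
      (Equiv.sum_comp (τ ^ k) fun x => W ((ρ ^ k) b, x)).trans ((hWr _).trans (hρk k b))]
    simp [mul_comm]
  · rw [← Finset.sum_div, Finset.sum_comm, div_eq_iff hN0']
    rw [Finset.sum_congr rfl fun k _ =>
      (Equiv.sum_comp (ρ ^ k) fun b => W (b, (τ ^ k) x)).trans ((hWc _).trans (hτk k x))]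
    simp [mul_comm]

/-- A self-map of a nonempty finite type permutes a nonempty finite set of points. -/
theorem exists_bijOn_of_finite [Finite ι] [Nonempty ι] (f : ι → ι) :
    ∃ P : Set ι, P.Nonempty ∧ BijOn f P P := by
  refine ⟨Function.periodicPts f, ?_, Function.bijOn_periodicPts f⟩
  obtain ⟨x⟩ := ‹Nonempty ι›
  have key : ∀ a b : ℕ, a < b → f^[a] x = f^[b] x → (Function.periodicPts f).Nonempty := by
    intro a b hlt hab
    refine ⟨f^[a] x, Function.mk_mem_periodicPts (n := b - a) (by omega) ?_⟩
    rw [Function.IsPeriodicPt, Function.IsFixedPt, ← Function.iterate_add_apply,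
      Nat.sub_add_cancel hlt.le, hab]
  obtain ⟨a, b, hne, hab⟩ := Finite.exists_ne_map_eq_of_infinite fun n : ℕ => f^[n] x
  rcases lt_or_gt_of_ne hne with h | h
  exacts [key a b h hab, key b a h hab.symm]

/-- A nonnegative square matrix whose row sums agree with its column sums comes from a weighted
permutation: its entries are distributed over finitely many edges that are permuted so that each
edge is followed by one which starts at its end. -/
theorem exists_perm_of_balanced (G : AddSubgroup ℝ) {ι : Type} [Fintype ι] (m : ι → ι → ℝ)
    (hm : ∀ i j, 0 ≤ m i j) (hG : ∀ i j, m i j ∈ G) (hbal : ∀ i, ∑ j, m i j = ∑ j, m j i) :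
    ∃ (E : Type) (_ : Fintype E) (t : E → ℝ) (σ : Equiv.Perm E) (s : E → ι × ι),
      (∀ e, 0 < t e) ∧ (∀ e, t e ∈ G) ∧ (∀ e, t (σ e) = t e) ∧
      (∀ e, (s (σ e)).1 = (s e).2) ∧ ∀ i j, pushWeight s t (i, j) = m i j := by
  classical
  -- Induction on the size of the support: view `m` as a flow on a directed graph and subtract
  -- cycles of constant flow.
  induction hn : (Finset.univ.filter fun p : ι × ι => m p.1 p.2 ≠ 0).card
    using Nat.strong_induction_on generalizing m with
  | _ n ih =>
  subst hn
  by_cases hz : ∀ i j, m i j = 0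
  · refine ⟨Empty, inferInstance, fun _ => 0, 1, Empty.elim, fun e => e.elim, fun e => e.elim,
      fun e => e.elim, fun e => e.elim, fun i j => ?_⟩
    simp [pushWeight, hz]
  push Not at hz
  obtain ⟨i₀, j₀, hij⟩ := hz
  have hpos : ∀ i j, m i j ≠ 0 → 0 < m i j := fun i j h => lt_of_le_of_ne (hm i j) h.symm
  -- By balance, flow entering `j` must leave it. Hence following a chosen outgoing edge never gets
  -- stuck, and the set `P` found below is a union of disjoint cycles.
  have hnext : ∀ i j, m i j ≠ 0 → ∃ k, m j k ≠ 0 := by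
    intro i j h
    by_contra! hk
    have h0 : ∑ k, m k j = 0 := by rw [← hbal, Finset.sum_eq_zero fun k _ => hk k]
    exact h ((Finset.sum_eq_zero_iff_of_nonneg fun k _ => hm k j).1 h0 i (Finset.mem_univ i))
  choose f hf using fun (i : {i // ∃ j, m i j ≠ 0}) => i.2
  let F : {i // ∃ j, m i j ≠ 0} → {i // ∃ j, m i j ≠ 0} := fun i => ⟨f i, hnext i _ (hf i)⟩
  have : Nonempty {i // ∃ j, m i j ≠ 0} := ⟨⟨i₀, j₀, hij⟩⟩
  obtain ⟨P, hPne, hP⟩ := exists_bijOn_of_finite F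
  let _ : Fintype P := Fintype.ofFinite P
  -- Subtracting the smallest flow along the cycles keeps `m` nonnegative and kills the entry at
  -- `x₀`.
  obtain ⟨x₀, hx₀, hmin⟩ := Set.exists_min_image P (fun i => m i (f i)) P.toFinite hPne
  set t₀ := m x₀ (f x₀) with ht₀
  have ht₀pos : 0 < t₀ := hpos _ _ (hf x₀)
  let σ₀ : Equiv.Perm P := hP.equiv
  have hσ₀ : ∀ e : P, ((σ₀ e : {i // ∃ j, m i j ≠ 0}) : ι) = f e := fun e => rfl
  let s₀ : P → ι × ι := fun e => (e.1.1, f e.1)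
  let c : ι → ι → ℝ := fun i j => pushWeight s₀ (fun _ => t₀) (i, j)
  have hs₀ : Function.Injective s₀ := fun a b h => Subtype.ext (Subtype.ext (congrArg Prod.fst h))
  have hc : ∀ i j, c i j = if (i, j) ∈ range s₀ then t₀ else 0 := by
    intro i j
    simp only [c, pushWeight]
    split_ifs with h
    · obtain ⟨e, he⟩ := h
      rw [← he, Finset.sum_eq_single e (fun b _ hb => if_neg fun h => hb (hs₀ h)) (by simp),
        if_pos rfl]
    · exact Finset.sum_eq_zero fun e _ => if_neg fun he => h ⟨e, he⟩
  have hcle : ∀ i j, c i j ≤ m i j := by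
    intro i j
    rw [hc]
    split_ifs with h
    · obtain ⟨e, he⟩ := h
      obtain ⟨rfl, rfl⟩ := Prod.mk.inj he
      exact hmin e.1 e.2
    · exact hm i j
  have hcG : ∀ i j, c i j ∈ G := by
    intro i j
    rw [hc]
    split_ifs
    exacts [hG _ _, G.zero_mem]
  have hcbal : ∀ i, ∑ j, c i j = ∑ j, c j i := by
    intro i
    simp only [c, pushWeight]
    rw [Finset.sum_comm]
    conv_rhs => rw [Finset.sum_comm]
    -- Each vertex of `P` is the start of one edge and the end of one edge; `σ₀` matches the two
    -- counts.
    rw [← Equiv.sum_comp σ₀]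
    refine Finset.sum_congr rfl fun e _ => ?_
    simp only [s₀, Prod.mk.injEq, hσ₀]
    by_cases h : f e.1 = i <;> simp [h]
  obtain ⟨E, _, t, σ, s, h1, h2, h3, h4, h5⟩ := ih _ (by
      refine Finset.card_lt_card (Finset.ssubset_iff_of_subset ?_ |>.2 ⟨(x₀.1, f x₀), ?_, ?_⟩)
      · intro p
        simp only [Finset.mem_filter, Finset.mem_univ, true_and]
        intro h h0
        have := hcle p.1 p.2
        have h' : 0 ≤ c p.1 p.2 := by rw [hc]; split_ifs; exacts [ht₀pos.le, le_rfl]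
        exact h (by rw [h0] at this ⊢; linarith)
      · simpa using hf x₀
      · have : (x₀.1, f x₀) ∈ range s₀ := ⟨⟨x₀, hx₀⟩, rfl⟩
        simp only [Finset.mem_filter, Finset.mem_univ, true_and, not_not]
        rw [hc, if_pos this, ← ht₀, sub_self])
    (fun i j => m i j - c i j) (fun i j => sub_nonneg.2 (hcle i j))
    (fun i j => G.sub_mem (hG i j) (hcG i j))
    (fun i => by rw [Finset.sum_sub_distrib, Finset.sum_sub_distrib, hbal, hcbal]) rfl
  refine ⟨P ⊕ E, inferInstance, Sum.elim (fun _ => t₀) t, Equiv.sumCongr σ₀ σ, Sum.elim s₀ s,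
    ?_, ?_, ?_, ?_, fun i j => ?_⟩
  · rintro (e | e)
    exacts [ht₀pos, h1 e]
  · rintro (e | e)
    exacts [hG _ _, h2 e]
  · rintro (e | e)
    exacts [rfl, h3 e]
  · rintro (e | e)
    exacts [hσ₀ e, h4 e]
  · have h6 := h5 i j
    rw [pushWeight_sumElim]
    linarith

end Combinatorics

/-! ### The group generated by a group-like set. -/

section ValueGroup

variable {V : Set ℝ}

theorem GroupLikeSet.mem_iff (hV : GroupLikeSet V) {x : ℝ} :
    x ∈ V ↔ x ∈ AddSubgroup.closure (V ∪ {1}) ∧ 0 ≤ x ∧ x ≤ 1 := by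
  conv_lhs => rw [hV.eq_span]
  rfl

theorem one_mem_closure : (1 : ℝ) ∈ AddSubgroup.closure (V ∪ {1}) :=
  AddSubgroup.subset_closure (by simp)

/-- The fractional part of an element of the group lies in the group and in `[0, 1]`, hence in `V`.
-/
theorem GroupLikeSet.add_int (hV : GroupLikeSet V) :
    V + range (fun k : ℤ => (k : ℝ)) = AddSubgroup.closure (V ∪ {1}) := by
  have hint : ∀ k : ℤ, (k : ℝ) ∈ AddSubgroup.closure (V ∪ {1}) := fun k => by
    simpa using AddSubgroup.zsmul_mem _ (one_mem_closure (V := V)) k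
  ext x
  constructor
  · rintro ⟨a, ha, _, ⟨k, rfl⟩, rfl⟩
    exact AddSubgroup.add_mem _ (hV.mem_iff.1 ha).1 (hint k)
  · intro hx
    refine ⟨Int.fract x, hV.mem_iff.2 ⟨?_, Int.fract_nonneg x, (Int.fract_lt_one x).le⟩,
      ⌊x⌋, ⟨⌊x⌋, rfl⟩, Int.fract_add_floor x⟩
    exact AddSubgroup.sub_mem _ hx (hint _)

theorem GroupLikeSet.qLikeSet_iff (hV : GroupLikeSet V) :
    QLikeSet V ↔ ∀ x ∈ AddSubgroup.closure (V ∪ {1}), ∀ n : ℕ, n ≠ 0 →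
      x / n ∈ AddSubgroup.closure (V ∪ {1}) := by
  constructor
  · rintro ⟨-, W, hW⟩ x hx n -
    rw [hV.add_int] at hW
    have hmem : ∀ y, y ∈ W ↔ y ∈ AddSubgroup.closure (V ∪ {1}) := fun y => by
      rw [← SetLike.mem_coe, hW, SetLike.mem_coe]
    have := W.smul_mem ((n : ℚ)⁻¹) ((hmem x).2 hx)
    rw [hmem, Rat.smul_def] at this
    convert this using 1
    push_cast
    rw [div_eq_inv_mul]
  · intro h
    refine ⟨hV, { AddSubgroup.closure (V ∪ {1}) with smul_mem' := fun q x hx => ?_ },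
      hV.add_int.symm⟩
    have h1 := AddSubgroup.zsmul_mem _ (h x hx q.den q.den_nz) q.num
    have h2 : q • x = q.num • (x / q.den) := by
      rw [Rat.smul_def, zsmul_eq_mul]
      conv_lhs => rw [← Rat.num_div_den q]
      push_cast
      ring
    change q • x ∈ AddSubgroup.closure (V ∪ {1})
    rwa [h2]

/-- A subgroup of `ℝ` is dense or cyclic, and a cyclic one containing `1` is `(1 / p) ℤ`, which is
excluded. -/
theorem GroupLikeSet.dense_closure (hV : GroupLikeSet V) :
    Dense (AddSubgroup.closure (V ∪ {1}) : Set ℝ) := by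
  rcases AddSubgroup.dense_or_cyclic (AddSubgroup.closure (V ∪ {1})) with h | ⟨a, ha⟩
  · exact h
  have h1 : (1 : ℝ) ∈ AddSubgroup.closure (V ∪ {1}) := one_mem_closure
  rw [ha, AddSubgroup.mem_closure_singleton] at h1
  obtain ⟨p, hp⟩ := h1
  rw [zsmul_eq_mul] at hp
  have hp0 : (p : ℝ) ≠ 0 := by
    rintro h
    rw [h, zero_mul] at hp
    exact zero_ne_one hp
  refine absurd (fun x hx => ?_) (hV.not_subset p (by exact_mod_cast hp0))
  have hx' := (hV.mem_iff.1 hx).1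
  rw [ha, AddSubgroup.mem_closure_singleton] at hx'
  obtain ⟨k, rfl⟩ := hx'
  refine ⟨k, ?_⟩
  rw [zsmul_eq_mul, eq_div_iff hp0, mul_assoc, mul_comm a, hp, mul_one]

end ValueGroup

/-! ### From weighted finite sets to probability algebras. -/

section WeightedAlgebra

variable {V : Set ℝ} {ι κ : Type u}

theorem sum_indicator_pushWeight [Fintype ι] [Fintype κ] (f : κ → ι) (w : κ → ℝ) (S : Set ι) :
    ∑ i, S.indicator (pushWeight f w) i = ∑ k, (f ⁻¹' S).indicator w k := by
  classical
  have h : ∀ i, S.indicator (pushWeight f w) i = ∑ k, if f k = i ∧ i ∈ S then w k else 0 :=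
    fun i => by by_cases hi : i ∈ S <;> simp [pushWeight, hi]
  rw [Finset.sum_congr rfl fun i _ => h i, Finset.sum_comm]
  refine Finset.sum_congr rfl fun k _ => ?_
  rw [Finset.sum_eq_single (f k) (fun i _ hi => if_neg fun h => hi h.1.symm) (by simp)]
  simp [indicator_apply]

/-- The algebra of subsets of a finite set of atoms with given weights, with the automorphism
induced by a permutation of the atoms. -/
noncomputable def FinProbAlgAut.ofWeights (hV : GroupLikeSet V) [Fintype ι] (w : ι → ℝ)
    (hw : ∀ i, 0 < w i) (hwG : ∀ i, w i ∈ AddSubgroup.closure (V ∪ {1})) (h1 : ∑ i, w i = 1)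
    (σ : Equiv.Perm ι) (hσ : ∀ i, w (σ i) = w i) : FinProbAlgAut.{u} V where
  carrier := Set ι
  meas S := ∑ i, S.indicator w i
  meas_mem S := by
    classical
    refine hV.mem_iff.2 ⟨AddSubgroup.sum_mem _ fun i _ => ?_,
      Finset.sum_nonneg fun i _ => indicator_nonneg (fun i _ => (hw i).le) i, ?_⟩
    · rw [indicator_apply]
      split_ifs
      exacts [hwG i, AddSubgroup.zero_mem _]
    · rw [← h1]
      exact Finset.sum_le_sum fun i _ => indicator_le_self' (fun i _ => (hw i).le) i
  meas_top := by simpa using h1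
  meas_sup S T h := by
    rw [← Finset.sum_add_distrib]
    exact Finset.sum_congr rfl fun i _ => congrFun (indicator_union_of_disjoint h w) i
  meas_pos S hS := by
    obtain ⟨i, hi⟩ := nonempty_iff_ne_empty.2 hS
    refine Finset.sum_pos' (fun i _ => indicator_nonneg (fun i _ => (hw i).le) i)
      ⟨i, Finset.mem_univ i, ?_⟩
    rw [indicator_of_mem hi]
    exact hw i
  aut :=
    { toFun := fun S => σ.symm ⁻¹' S
      invFun := fun S => σ ⁻¹' S
      left_inv := fun S => by ext; simp
      right_inv := fun S => by ext; simp
      map_rel_iff' := fun {S T} => by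
        refine ⟨fun h i hi => ?_, fun h i hi => h hi⟩
        simpa using @h (σ i) (by simpa using hi) }
  meas_aut S := by
    classical
    refine (Equiv.sum_comp σ _).symm.trans (Finset.sum_congr rfl fun i _ => ?_)
    simp [indicator_apply, hσ]

theorem FinProbAlg.meas_bot (A : FinProbAlg.{u} V) : A.meas ⊥ = 0 := by
  have := A.meas_sup ⊥ ⊥ disjoint_bot_left
  rw [sup_idem] at this
  linarith

/-- If `x` and `y` have the same image, `x \ y` has measure zero, so it is `⊥` by strict positivity.
-/
theorem BoundedLatticeHom.injective_of_meas_map {A B : FinProbAlg.{u} V}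
    (φ : BoundedLatticeHom A.carrier B.carrier) (h : ∀ a, B.meas (φ a) = A.meas a) :
    Function.Injective φ := by
  have key : ∀ x y, φ x = φ y → x ≤ y := fun x y hxy => by
    rw [← sdiff_eq_bot_iff]
    by_contra hne
    have := A.meas_pos _ hne
    rw [← h, map_sdiff', hxy, _root_.sdiff_self, B.meas_bot] at this
    exact lt_irrefl _ this
  exact fun x y hxy => le_antisymm (key x y hxy) (key y x hxy.symm)

/-- An equivariant, weight-preserving map of atoms induces an embedding of algebras. -/
def FinProbAlgAut.Emb.ofMap (hV : GroupLikeSet V) [Fintype ι] [Fintype κ] {w : ι → ℝ}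
    {hw : ∀ i, 0 < w i} {hwG : ∀ i, w i ∈ AddSubgroup.closure (V ∪ {1})} {h1 : ∑ i, w i = 1}
    {σ : Equiv.Perm ι} {hσ : ∀ i, w (σ i) = w i} {w' : κ → ℝ}
    {hw' : ∀ i, 0 < w' i} {hwG' : ∀ i, w' i ∈ AddSubgroup.closure (V ∪ {1})}
    {h1' : ∑ i, w' i = 1} {σ' : Equiv.Perm κ} {hσ' : ∀ i, w' (σ' i) = w' i} (f : κ → ι)
    (hf : pushWeight f w' = w) (hfσ : ∀ k, f (σ' k) = σ (f k)) :
    (ofWeights hV w hw hwG h1 σ hσ).Emb (ofWeights hV w' hw' hwG' h1' σ' hσ') :=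
  let φ : BoundedLatticeHom (Set ι) (Set κ) :=
    { toFun := fun S => f ⁻¹' S
      map_sup' := fun _ _ => rfl
      map_inf' := fun _ _ => rfl
      map_top' := rfl
      map_bot' := rfl }
  have hφ : ∀ S : Set ι, ∑ k, (φ S).indicator w' k = ∑ i, S.indicator w i := fun S => by
    rw [← hf, sum_indicator_pushWeight]
    rfl
  { toHom := φ
    injective := BoundedLatticeHom.injective_of_meas_map
      (A := (ofWeights hV w hw hwG h1 σ hσ).toFinProbAlg)
      (B := (ofWeights hV w' hw' hwG' h1' σ' hσ').toFinProbAlg) φ hφ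
    meas_map := hφ
    map_aut := fun (S : Set ι) => by
      refine Set.ext fun (k : κ) => ?_
      change σ.symm (f k) ∈ S ↔ f (σ'.symm k) ∈ S
      have : σ.symm (f k) = f (σ'.symm k) := by
        rw [Equiv.symm_apply_eq, ← hfσ, Equiv.apply_symm_apply]
      rw [this] }

end WeightedAlgebra

/-! ### From probability algebras back to their atoms. -/

section Atoms

variable {V : Set ℝ}

theorem FinProbAlg.meas_finset_sup (A : FinProbAlg.{u} V) (s : Finset {a : A.carrier // IsAtom a}) :
    A.meas (s.sup fun a => a.1) = ∑ a ∈ s, A.meas a.1 := by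
  classical
  induction s using Finset.induction_on with
  | empty => simpa using A.meas_bot
  | insert a s ha ih =>
    rw [Finset.sup_insert, Finset.sum_insert ha, A.meas_sup, ih]
    rw [Finset.disjoint_sup_right]
    intro b hb
    refine a.2.disjoint_of_ne b.2 fun h => ha ?_
    rwa [Subtype.ext h]

open Classical in
theorem FinProbAlg.meas_eq_sum (A : FinProbAlg.{u} V) [Fintype {a : A.carrier // IsAtom a}]
    (x : A.carrier) :
    A.meas x = ∑ a : {a : A.carrier // IsAtom a}, if a.1 ≤ x then A.meas a.1 else 0 := by
  rw [← Finset.sum_filter, ← A.meas_finset_sup]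
  congr 1
  refine le_antisymm ?_ (Finset.sup_le fun a ha => by simpa using ha)
  rw [← sdiff_eq_bot_iff]
  by_contra hne
  obtain ⟨a, ha, hle⟩ := (eq_bot_or_exists_atom_le _).resolve_left hne
  have h1 : a ≤ (Finset.univ.filter fun a : {a : A.carrier // IsAtom a} => a.1 ≤ x).sup
      fun a => a.1 :=
    Finset.le_sup (f := fun a : {a : A.carrier // IsAtom a} => a.1) (b := ⟨a, ha⟩)
      (by simpa using hle.trans sdiff_le)
  exact ha.1 (le_bot_iff.1 ((le_inf hle h1).trans inf_sdiff_self_left.le))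

theorem IsAtom.le_sup_iff_or {B : Type*} [BooleanAlgebra B] {a x y : B} (ha : IsAtom a) :
    a ≤ x ⊔ y ↔ a ≤ x ∨ a ≤ y := by
  refine ⟨fun h => ?_, fun h => h.elim le_sup_of_le_left le_sup_of_le_right⟩
  by_contra! hne
  have hx : a ⊓ x = ⊥ := (ha.le_iff.1 inf_le_left).resolve_right fun h => hne.1 (inf_eq_left.1 h)
  have hy : a ⊓ y = ⊥ := (ha.le_iff.1 inf_le_left).resolve_right fun h => hne.2 (inf_eq_left.1 h)
  have := inf_eq_left.2 h
  rw [inf_sup_left, hx, hy, sup_idem] at this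
  exact ha.1 this.symm

/-- The elements whose image lies above an atom `b` form an ultrafilter; in a finite algebra it is
principal, generated by an atom. This is the dual map on atoms. -/
theorem exists_atom_map {A B : Type*} [BooleanAlgebra A] [BooleanAlgebra B] [Finite A]
    (i : BoundedLatticeHom A B) :
    ∃ f : {b : B // IsAtom b} → {a : A // IsAtom a}, ∀ b x, b.1 ≤ i x ↔ (f b).1 ≤ x := by
  have key : ∀ b : {b : B // IsAtom b}, ∃ a : {a : A // IsAtom a}, ∀ x, b.1 ≤ i x ↔ a.1 ≤ x := by
    intro b
    obtain ⟨a, ha⟩ := (Set.toFinite {a : A | b.1 ≤ i a}).exists_minimal ⟨⊤, by simp⟩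
    have hba : b.1 ≤ i a := ha.prop
    have hcase : ∀ x, ¬ b.1 ≤ i x → a ≤ xᶜ := fun x hx => by
      have hx' : b.1 ≤ i xᶜ := by
        have h1 : Disjoint b.1 (i x) := by
          rw [disjoint_iff]
          exact (b.2.le_iff.1 inf_le_left).resolve_right fun h => hx (inf_eq_left.1 h)
        rw [map_compl', le_compl_iff_disjoint_right]
        exact h1
      exact inf_eq_left.1 (ha.eq_of_le (show b.1 ≤ i (a ⊓ xᶜ) by
        rw [map_inf]; exact le_inf hba hx') inf_le_left)
    have hax : ∀ x, b.1 ≤ i x ↔ a ≤ x := fun x => by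
      refine ⟨fun h => ?_, fun h => hba.trans (OrderHomClass.mono i h)⟩
      exact inf_eq_left.1 (ha.eq_of_le (show b.1 ≤ i (a ⊓ x) by
        rw [map_inf]; exact le_inf hba h) inf_le_left)
    refine ⟨⟨a, fun h => ?_, fun x hx => ?_⟩, hax⟩
    · rw [h, map_bot, le_bot_iff] at hba
      exact b.2.1 hba
    · by_contra hne
      by_cases h : b.1 ≤ i x
      · exact hx.not_ge ((hax x).1 h)
      · exact hne (disjoint_self.1 (
          (hx.le.trans (hcase x h)).disjoint_compl_right.mono_right (by simp)))
  choose f hf using key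
  exact ⟨f, hf⟩

/-- The permutation of the atoms induced by an automorphism of a Boolean algebra. -/
def atomPerm {A : Type*} [BooleanAlgebra A] (φ : A ≃o A) : Equiv.Perm {a : A // IsAtom a} :=
  φ.toEquiv.subtypeEquiv fun a => (φ.isAtom_iff a).symm

theorem atom_map_perm {A B : Type*} [BooleanAlgebra A] [BooleanAlgebra B]
    {i : BoundedLatticeHom A B} {f : {b : B // IsAtom b} → {a : A // IsAtom a}}
    (hf : ∀ b x, b.1 ≤ i x ↔ (f b).1 ≤ x) {φ : A ≃o A} {ψ : B ≃o B}
    (h : ∀ a, i (φ a) = ψ (i a)) (b : {b : B // IsAtom b}) :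
    f (atomPerm ψ b) = atomPerm φ (f b) := by
  have key : ∀ x, (f (atomPerm ψ b)).1 ≤ x ↔ (atomPerm φ (f b)).1 ≤ x := fun x => by
    change _ ↔ φ (f b).1 ≤ x
    rw [← hf, ← OrderIso.le_symm_apply, ← hf]
    change ψ b.1 ≤ i x ↔ _
    obtain ⟨y, rfl⟩ := φ.surjective x
    rw [h, ψ.le_iff_le, φ.symm_apply_apply]
  exact Subtype.ext (le_antisymm ((key _).2 le_rfl) ((key _).1 le_rfl))

/-- The atoms sent to `a` are exactly those below `i a`. -/
theorem pushWeight_atom_map {A B : FinProbAlg.{u} V} [Fintype {b : B.carrier // IsAtom b}]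
    {i : BoundedLatticeHom A.carrier B.carrier}
    (hi : ∀ a, B.meas (i a) = A.meas a)
    {f : {b : B.carrier // IsAtom b} → {a : A.carrier // IsAtom a}}
    (hf : ∀ b x, b.1 ≤ i x ↔ (f b).1 ≤ x) :
    pushWeight f (fun b => B.meas b.1) = fun a => A.meas a.1 := by
  funext a
  rw [← hi, B.meas_eq_sum]
  unfold pushWeight
  refine Finset.sum_congr rfl fun b _ => ?_
  have : f b = a ↔ b.1 ≤ i a.1 := by
    rw [hf, a.2.le_iff_eq (f b).2.1, Subtype.ext_iff]
  by_cases hb : b.1 ≤ i a.1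
  · rw [if_pos hb, if_pos (this.2 hb)]
  · rw [if_neg hb, if_neg (mt this.1 hb)]

/-- The dual of a coupling: projections of an invariant coupling of the atoms give embeddings. -/
def FinProbAlgAut.Emb.ofAtoms (hV : GroupLikeSet V) {ι : Type u} [Fintype ι] {w : ι → ℝ}
    {hw : ∀ i, 0 < w i} {hwG : ∀ i, w i ∈ AddSubgroup.closure (V ∪ {1})} {h1 : ∑ i, w i = 1}
    {σ : Equiv.Perm ι} {hσ : ∀ i, w (σ i) = w i} {B : FinProbAlgAut.{u} V}
    [Fintype {b : B.carrier // IsAtom b}]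
    (π : ι → {b : B.carrier // IsAtom b}) (hπ : pushWeight π w = fun b => B.meas b.1)
    (hπσ : ∀ k, π (σ k) = atomPerm B.aut (π k)) :
    B.Emb (ofWeights hV w hw hwG h1 σ hσ) :=
  let φ : BoundedLatticeHom B.carrier (Set ι) :=
    { toFun := fun x => {k | (π k).1 ≤ x}
      map_sup' := fun x y => Set.ext fun k => by
        change (π k).1 ≤ x ⊔ y ↔ (π k).1 ≤ x ∨ (π k).1 ≤ y
        exact (π k).2.le_sup_iff_or
      map_inf' := fun _ _ => Set.ext fun k => le_inf_iff
      map_top' := Set.ext fun k => by simp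
      map_bot' := Set.ext fun k => by simpa using (π k).2.1 }
  have hφ : ∀ x : B.carrier, ∑ k, (φ x).indicator w k = B.meas x := fun x => by
    classical
    rw [B.meas_eq_sum]
    refine (sum_indicator_pushWeight π w {b | b.1 ≤ x}).symm.trans
      (Finset.sum_congr rfl fun b _ => ?_)
    simp [indicator_apply, hπ]
  { toHom := φ
    injective := BoundedLatticeHom.injective_of_meas_map
      (B := (ofWeights hV w hw hwG h1 σ hσ).toFinProbAlg) φ hφ
    meas_map := hφ
    map_aut := fun x => by
      refine Set.ext fun k => ?_
      change (π k).1 ≤ B.aut x ↔ (π (σ.symm k)).1 ≤ x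
      obtain ⟨l, rfl⟩ := σ.surjective k
      rw [hπσ, σ.symm_apply_apply]
      exact B.aut.le_iff_le }

end Atoms

/-! ### Amalgamation is equivalent to divisibility. -/

theorem QLikeSet.autAmalgamation {V : Set ℝ} (hV : GroupLikeSet V) (h : QLikeSet V) :
    AutAmalgamation.{u} V := by
  classical
  intro A B C i j
  rw [hV.qLikeSet_iff] at h
  let _ : Fintype {b : B.carrier // IsAtom b} := Fintype.ofFinite _
  let _ : Fintype {c : C.carrier // IsAtom c} := Fintype.ofFinite _
  obtain ⟨f, hf⟩ := exists_atom_map i.toHom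
  obtain ⟨g, hg⟩ := exists_atom_map j.toHom
  obtain ⟨W, hWG, hW0, hWs, hWi, hWr, hWc⟩ := exists_invariant_coupling _ h f g
    (fun b => B.meas b.1) (fun c => C.meas c.1)
    (fun b => (B.meas_pos _ b.2.1).le) (fun b => (hV.mem_iff.1 (B.meas_mem _)).1)
    (fun c => (C.meas_pos _ c.2.1).le) (fun c => (hV.mem_iff.1 (C.meas_mem _)).1)
    ((pushWeight_atom_map i.meas_map hf).trans (pushWeight_atom_map j.meas_map hg).symm)
    (atomPerm A.aut) (atomPerm B.aut) (atomPerm C.aut)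
    (atom_map_perm hf i.map_aut) (atom_map_perm hg j.map_aut)
    (fun b => B.meas_aut _) (fun c => C.meas_aut _)
  -- Pairs of weight zero are dropped: the measure becomes strictly positive, and all remaining
  -- pairs lie in the fibred product, which makes the square commute.
  let ι := {p : {b : B.carrier // IsAtom b} × {c : C.carrier // IsAtom c} // W p ≠ 0}
  let σ : Equiv.Perm ι := ((atomPerm B.aut).prodCongr (atomPerm C.aut)).subtypeEquiv
    fun p => by rw [← hWi p]; rfl
  have hsum : ∀ F : {b : B.carrier // IsAtom b} × {c : C.carrier // IsAtom c} → Prop,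
      ∑ p : ι, (if F p.1 then W p.1 else 0) = ∑ p, if F p then W p else 0 := fun F => by
    rw [← Finset.sum_filter_of_ne (p := fun p => W p ≠ 0) fun p _ h => fun h0 => h (by simp [h0])]
    exact (Finset.sum_subtype _ (by simp) fun p => if F p then W p else 0).symm
  refine ⟨FinProbAlgAut.ofWeights hV (fun p : ι => W p.1)
      (fun p => lt_of_le_of_ne (hW0 _) p.2.symm) (fun p => hWG _) ?_ σ (fun p => hWi _),
    .ofAtoms hV (fun p => p.1.1) (funext fun b => ?_) (fun p => rfl),
    .ofAtoms hV (fun p => p.1.2) (funext fun c => ?_) (fun p => rfl), fun a => ?_⟩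
  · have := hsum fun _ => True
    simp only [if_true] at this
    rw [this, Fintype.sum_prod_type, Finset.sum_congr rfl fun b _ => hWr b, ← B.meas_top,
      B.meas_eq_sum]
    simp
  · refine (hsum fun p => p.1 = b).trans ?_
    rw [Fintype.sum_prod_type, Finset.sum_eq_single b (fun b' _ hb => by simp [hb]) (by simp)]
    simpa using hWr b
  · refine (hsum fun p => p.2 = c).trans ?_
    rw [Fintype.sum_prod_type_right, Finset.sum_eq_single c (fun b' _ hb => by simp [hb]) (by simp)]
    simpa using hWc c
  · refine Set.ext fun p => ?_
    change p.1.1.1 ≤ i.toHom a ↔ p.1.2.1 ≤ j.toHom a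
    rw [hf, hg, hWs _ p.2]

theorem sum_ulift {κ : Type} [Fintype κ] (f : ULift.{u} κ → ℝ) : ∑ k, f k = ∑ k, f ⟨k⟩ :=
  (Equiv.sum_comp Equiv.ulift.symm f).symm

/-- Over an atom of mass `n * z`, amalgamate a fixed piece of mass `x` with `n` cyclically permuted
pieces of mass `z`. The bounds on `x` and `z` make all weights positive. -/
theorem exists_smul_of_autAmalgamation {V : Set ℝ} (hV : GroupLikeSet V)
    (h : AutAmalgamation.{u} V) {n : ℕ} (hn : n ≠ 0) {x z : ℝ}
    (hx : x ∈ AddSubgroup.closure (V ∪ {1})) (hz : z ∈ AddSubgroup.closure (V ∪ {1}))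
    (hx0 : 0 < x) (hxz : x < n * z) (hz1 : n * z < 1) :
    x / n ∈ AddSubgroup.closure (V ∪ {1}) := by
  classical
  have hn' : (0 : ℝ) < n := Nat.cast_pos.2 (Nat.pos_of_ne_zero hn)
  have hz0 : 0 < z := pos_of_mul_pos_right (hx0.trans hxz) hn'.le
  have h1 : (1 : ℝ) ∈ AddSubgroup.closure (V ∪ {1}) := one_mem_closure
  have hnz : n * z ∈ AddSubgroup.closure (V ∪ {1}) := by
    simpa using AddSubgroup.nsmul_mem _ hz n
  have hr := AddSubgroup.sub_mem _ h1 hnz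
  let wA : ULift.{u} (Unit ⊕ Unit) → ℝ := fun k =>
    Sum.elim (fun _ => n * z) (fun _ => 1 - n * z) k.down
  let wB : ULift.{u} (Bool ⊕ Unit) → ℝ := fun k =>
    Sum.elim (fun b => if b then x else n * z - x) (fun _ => 1 - n * z) k.down
  let wC : ULift.{u} (ZMod n ⊕ Unit) → ℝ := fun k =>
    Sum.elim (fun _ => z) (fun _ => 1 - n * z) k.down
  have : NeZero n := ⟨hn⟩
  let σC : Equiv.Perm (ULift.{u} (ZMod n ⊕ Unit)) :=
    Equiv.ulift.trans (((Equiv.addRight (1 : ZMod n)).sumCongr (Equiv.refl Unit)).trans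
      Equiv.ulift.symm)
  let A := FinProbAlgAut.ofWeights hV wA
    (by rintro ⟨_ | _⟩ <;> simp [wA] <;> linarith)
    (by rintro ⟨_ | _⟩; exacts [hnz, hr])
    (by rw [sum_ulift]; simp [wA]) 1 (fun _ => rfl)
  let B := FinProbAlgAut.ofWeights hV wB
    (by rintro ⟨(_ | _) | _⟩ <;> simp [wB] <;> linarith)
    (by
      rintro ⟨(_ | _) | _⟩
      exacts [by simpa [wB, -Set.union_singleton] using AddSubgroup.sub_mem _ hnz hx,
        by simpa [wB, -Set.union_singleton] using hx, hr])
    (by rw [sum_ulift]; simp [wB]) 1 (fun _ => rfl)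
  let C := FinProbAlgAut.ofWeights hV wC
    (by rintro ⟨_ | _⟩ <;> simp [wC] <;> linarith)
    (by rintro ⟨_ | _⟩; exacts [hz, hr])
    (by rw [sum_ulift]; simp [wC]) σC (by rintro ⟨_ | _⟩ <;> rfl)
  let i : A.Emb B := .ofMap hV (fun k => ⟨k.down.map (fun _ => ()) id⟩)
    (by
      funext k
      unfold pushWeight
      rw [sum_ulift]
      rcases k with ⟨_ | _⟩ <;> simp [wA, wB, ULift.ext_iff])
    (fun k => rfl)
  let j : A.Emb C := .ofMap hV (fun k => ⟨k.down.map (fun _ => ()) id⟩)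
    (by
      funext k
      unfold pushWeight
      rw [sum_ulift]
      rcases k with ⟨_ | _⟩ <;> simp [wA, wC, ULift.ext_iff])
    (by rintro ⟨_ | _⟩ <;> rfl)
  obtain ⟨D, β, γ, hD⟩ := h A B C i j
  let SB : Set (ULift.{u} (Bool ⊕ Unit)) := {⟨Sum.inl true⟩}
  let SC : Finset (ZMod n) → Set (ULift.{u} (ZMod n ⊕ Unit)) := fun s =>
    {q | ∃ k ∈ s, q = ⟨Sum.inl k⟩}
  let SA : Set (ULift.{u} (Unit ⊕ Unit)) := {⟨Sum.inl ()⟩}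
  let b : D.carrier := β.toHom SB
  let c : Finset (ZMod n) → D.carrier := fun s => γ.toHom (SC s)
  have hb : D.meas b = x := by
    refine (β.meas_map SB).trans ?_
    change ∑ k, SB.indicator wB k = x
    rw [sum_ulift]
    simp [SB, wB, indicator_apply]
  have hbaut : D.aut b = b := (β.map_aut SB).symm
  have hcaut : ∀ k, D.aut (c {k}) = c {k + 1} := fun k => by
    refine (γ.map_aut (SC {k})).symm.trans (congrArg γ.toHom ?_)
    refine Set.ext fun (q : ULift.{u} (ZMod n ⊕ Unit)) => ?_
    change (∃ l ∈ ({k} : Finset (ZMod n)), σC.symm q = ⟨Sum.inl l⟩) ↔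
      ∃ l ∈ ({k + 1} : Finset (ZMod n)), q = ⟨Sum.inl l⟩
    simp only [Finset.mem_singleton, exists_eq_left, Equiv.symm_apply_eq]
    rfl
  have hstep : ∀ k, D.meas (b ⊓ c {k + 1}) = D.meas (b ⊓ c {k}) := fun k => by
    rw [← hcaut, ← D.meas_aut (b ⊓ c {k}), map_inf, hbaut]
  have hconst : ∀ k : ℕ, D.meas (b ⊓ c {(k : ZMod n)}) = D.meas (b ⊓ c {0}) := fun k => by
    induction k with
    | zero => simp
    | succ k ih => rw [Nat.cast_succ, hstep, ih]
  have hsum : ∀ s : Finset (ZMod n), D.meas (b ⊓ c s) = s.card * D.meas (b ⊓ c {0}) := fun s => by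
    induction s using Finset.induction_on with
    | empty =>
      have : SC ∅ = ⊥ := by ext; simp [SC]
      have : c ∅ = ⊥ := (congrArg γ.toHom this).trans (map_bot γ.toHom)
      rw [this, inf_bot_eq, D.meas_bot]
      simp
    | insert a s ha ih =>
      have h1 : SC (insert a s) = SC {a} ⊔ SC s := by ext q; simp [SC]
      have h2 : c (insert a s) = c {a} ⊔ c s :=
        (congrArg γ.toHom h1).trans (γ.toHom.map_sup' (SC {a}) (SC s))
      have h3 : SC {a} ⊓ SC s = ⊥ := by
        ext q
        simp only [SC, Finset.mem_singleton, exists_eq_left]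
        refine ⟨?_, fun h => h.elim⟩
        rintro ⟨rfl, k, hk, hq⟩
        have : a = k := by simpa using hq
        exact ha (this ▸ hk)
      have h4 : c {a} ⊓ c s = ⊥ :=
        ((γ.toHom.map_inf' (SC {a}) (SC s)).symm.trans (congrArg γ.toHom h3)).trans
          (map_bot γ.toHom)
      rw [h2, inf_sup_left, D.meas_sup _ _
        ((disjoint_iff.2 h4).mono inf_le_right inf_le_right), ih, Finset.card_insert_of_notMem ha,
        ← ZMod.natCast_zmod_val a, hconst]
      push_cast
      ring
  -- Commutativity of the square: `b` lies below the image of the common atom, which on the side of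
  -- `C` is the union of the whole cycle.
  have htop : b ⊓ c Finset.univ = b := by
    rw [inf_eq_left]
    have h1 : SB ⊆ i.toHom SA := by
      rintro _ rfl
      rfl
    have h2 : j.toHom SA = SC Finset.univ := by
      refine Set.ext fun (q : ULift.{u} (ZMod n ⊕ Unit)) => ?_
      change (⟨q.down.map (fun _ => ()) id⟩ : ULift.{u} (Unit ⊕ Unit)) = ⟨Sum.inl ()⟩ ↔
        ∃ l ∈ Finset.univ, q = ⟨Sum.inl l⟩
      rcases q with ⟨_ | _⟩ <;> simp
    have h3 := (hD SA).trans (congrArg γ.toHom h2)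
    exact (OrderHomClass.mono β.toHom h1).trans h3.le
  have := hsum Finset.univ
  rw [htop, hb, Finset.card_univ, ZMod.card] at this
  rw [this, mul_div_cancel_left₀ _ hn'.ne']
  exact (hV.mem_iff.1 (D.meas_mem _)).1

theorem AutAmalgamation.qLikeSet {V : Set ℝ} (hV : GroupLikeSet V)
    (h : AutAmalgamation.{u} V) : QLikeSet V := by
  refine hV.qLikeSet_iff.2 fun x hx n hn => ?_
  have hn' : (0 : ℝ) < n := Nat.cast_pos.2 (Nat.pos_of_ne_zero hn)
  -- Reduce to small `x`: `0 < x - n * y < 1 / 2 < n * z < 1`, and `n * y` is divisible by `n` in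
  -- the group.
  obtain ⟨y, hy, hy1, hy2⟩ := hV.dense_closure.exists_between
    (show (x - 1 / 2) / n < x / n by gcongr; linarith)
  obtain ⟨z, hz, hz1, hz2⟩ := hV.dense_closure.exists_between
    (show 1 / 2 / (n : ℝ) < 1 / n by gcongr; norm_num)
  rw [div_lt_iff₀ hn'] at hy1 hz1
  rw [lt_div_iff₀ hn'] at hy2 hz2
  have hny : n * y ∈ AddSubgroup.closure (V ∪ {1}) := by
    simpa using AddSubgroup.nsmul_mem _ hy n
  have := exists_smul_of_autAmalgamation hV h hn (AddSubgroup.sub_mem _ hx hny) hz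
    (by linarith) (by linarith) (by linarith)
  rw [sub_div, mul_div_cancel_left₀ _ hn'.ne'] at this
  simpa using AddSubgroup.add_mem _ this hy

/-! ### Homeomorphisms from directed systems of partition pairs. -/

section BackAndForth

variable {X : Type v} [TopologicalSpace X] [MeasurableSpace X] {μ : Measure X}

theorem measureReal_pos_of_isOpen [IsFiniteMeasure μ] [μ.IsOpenPosMeasure] {U : Set X}
    (hU : IsOpen U) (hne : U.Nonempty) : 0 < μ.real U :=
  ENNReal.toReal_pos (hU.measure_pos μ hne).ne' (measure_ne_top μ U)

variable (μ) in
/-- Two finite clopen partitions of `X`, indexed in such a way that corresponding pieces have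
the same measure. -/
structure PartitionPair where
  /-- the index set -/
  ι : Type
  [fintype : Fintype ι]
  /-- the first partition -/
  p : X → ι
  /-- the second partition -/
  q : X → ι
  hp : IsLocallyConstant p
  hq : IsLocallyConstant q
  meas_eq : ∀ i, μ.real (p ⁻¹' {i}) = μ.real (q ⁻¹' {i})

attribute [instance] PartitionPair.fintype

/-- Larger means finer; a single `f` serves both sides, so the matching of pieces is respected. -/
instance : Preorder (PartitionPair μ) where
  le P P' := ∃ f : P'.ι → P.ι, f ∘ P'.p = P.p ∧ f ∘ P'.q = P.q
  le_refl P := ⟨id, rfl, rfl⟩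
  le_trans P P' P'' := by
    rintro ⟨f, hf, hf'⟩ ⟨f', hf1, hf1'⟩
    exact ⟨f ∘ f', by rw [Function.comp_assoc, hf1, hf], by rw [Function.comp_assoc, hf1', hf']⟩

/-- Exchange the two partitions. -/
def PartitionPair.swap (P : PartitionPair μ) : PartitionPair μ where
  ι := P.ι
  p := P.q
  q := P.p
  hp := P.hq
  hq := P.hp
  meas_eq i := (P.meas_eq i).symm

theorem PartitionPair.swap_le_swap {P P' : PartitionPair μ} (h : P ≤ P') : P.swap ≤ P'.swap := by
  obtain ⟨f, hf, hf'⟩ := h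
  exact ⟨f, hf', hf⟩

/-- Compactness: the piece matched with a piece containing `x` has the same positive measure, hence
is nonempty. -/
theorem exists_image_point [CompactSpace X] [IsFiniteMeasure μ] [μ.IsOpenPosMeasure]
    {J : Type*} [Nonempty J] (P : J → PartitionPair μ) (hP : Directed (· ≤ ·) P) (x : X) :
    ∃ y, ∀ j, (P j).q y = (P j).p x := by
  have hcl : ∀ j, IsClosed ((P j).q ⁻¹' {(P j).p x}) := fun j => ((P j).hq.isClopen_fiber _).1
  have := IsCompact.nonempty_iInter_of_directed_nonempty_isCompact_isClosed
    (fun j => (P j).q ⁻¹' {(P j).p x}) (fun i j => by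
      obtain ⟨k, ⟨f, hf, hf'⟩, ⟨f', hf1, hf1'⟩⟩ := hP i j
      refine ⟨k, fun y hy => ?_, fun y hy => ?_⟩
      · have hy : (P k).q y = (P k).p x := hy
        simp [← hf, ← hf', hy]
      · have hy : (P k).q y = (P k).p x := hy
        simp [← hf1, ← hf1', hy])
    (fun j => by
      rw [nonempty_iff_ne_empty]
      intro h
      have h1 := measureReal_pos_of_isOpen (μ := μ) ((P j).hp.isOpen_fiber ((P j).p x)) ⟨x, rfl⟩
      rw [show {y | (P j).p y = (P j).p x} = (P j).p ⁻¹' {(P j).p x} from rfl, (P j).meas_eq, h,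
        measureReal_empty] at h1
      exact lt_irrefl _ h1)
    (fun j => (hcl j).isCompact) hcl
  obtain ⟨y, hy⟩ := this
  exact ⟨y, fun j => mem_iInter.1 hy j⟩

variable [BorelSpace X]

theorem measureReal_preimage_eq_sum [IsFiniteMeasure μ] {ι : Type*} [Fintype ι] {p : X → ι}
    (hp : IsLocallyConstant p) (S : Set ι) :
    μ.real (p ⁻¹' S) = ∑ i, S.indicator (fun i => μ.real (p ⁻¹' {i})) i := by
  classical
  have h1 : p ⁻¹' S = ⋃ i ∈ Finset.univ.filter (· ∈ S), p ⁻¹' {i} := by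
    ext x
    simp
  rw [h1, measureReal_biUnion_finset]
  · rw [Finset.sum_filter]
    simp [indicator_apply]
  · intro i _ j _ hij
    exact Disjoint.preimage p (by simpa using hij)
  · exact fun i _ => (hp.isOpen_fiber i).measurableSet

theorem pushWeight_measureReal [IsFiniteMeasure μ] {ι κ : Type*} [Fintype κ] {q : X → κ}
    (hq : IsLocallyConstant q) (f : κ → ι) (i : ι) :
    pushWeight f (fun k => μ.real (q ⁻¹' {k})) i = μ.real ((f ∘ q) ⁻¹' {i}) := by
  classical
  rw [preimage_comp, measureReal_preimage_eq_sum hq]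
  simp [pushWeight, indicator_apply]

/-- Clopen sets form a π-system that generates the Borel sets. -/
theorem homeomorph_measurePreserving [CompactSpace X] [T2Space X] [TotallyDisconnectedSpace X]
    [SecondCountableTopology X] [IsFiniteMeasure μ] (g : X ≃ₜ X)
    (h : ∀ U, IsClopen U → μ.real (g ⁻¹' U) = μ.real U) : MeasurePreserving g μ μ := by
  refine ⟨g.measurable, ?_⟩
  refine ext_of_generate_finite {s : Set X | IsClopen s} ?_ ?_ ?_ ?_
  · rw [BorelSpace.measurable_eq (α := X)]
    exact isTopologicalBasis_isClopen.borel_eq_generateFrom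
  · exact fun U hU W hW _ => hU.inter hW
  · intro U hU
    rw [Measure.map_apply g.measurable hU.isOpen.measurableSet]
    exact (measureReal_eq_measureReal_iff).1 (h U hU)
  · rw [Measure.map_apply g.measurable MeasurableSet.univ, preimage_univ]

variable [CompactSpace X] [T2Space X] [TotallyDisconnectedSpace X] [SecondCountableTopology X]

/-- A directed system of pairs of partitions in which both sides exhaust all clopen sets is
induced by a measure-preserving homeomorphism. -/
theorem exists_homeo_of_directed [IsFiniteMeasure μ] [μ.IsOpenPosMeasure]
    {J : Type*} [Nonempty J] (P : J → PartitionPair μ) (hP : Directed (· ≤ ·) P)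
    (hp : ∀ U, IsClopen U → ∃ j S, U = (P j).p ⁻¹' S)
    (hq : ∀ U, IsClopen U → ∃ j S, U = (P j).q ⁻¹' S) :
    ∃ g : homeoPreserving μ, ∀ j x, (P j).q (g.1 x) = (P j).p x := by
  choose g hg using exists_image_point P hP
  choose h hh using exists_image_point (fun j => (P j).swap) fun i j =>
    (hP i j).imp fun k hk => ⟨PartitionPair.swap_le_swap hk.1, PartitionPair.swap_le_swap hk.2⟩
  have hh : ∀ y j, (P j).p (h y) = (P j).q y := hh
  -- Since the partitions exhaust the clopen sets, they separate points; this forces `g` and `h` to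
  -- be mutually inverse.
  have hsepq : ∀ x y, (∀ j, (P j).q x = (P j).q y) → x = y := fun x y hxy => by
    by_contra hne
    obtain ⟨U, hU, hx, hy⟩ := exists_isClopen_of_totally_separated hne
    obtain ⟨j, S, rfl⟩ := hq U hU
    exact hy (by simpa [hxy j] using hx)
  have hsepp : ∀ x y, (∀ j, (P j).p x = (P j).p y) → x = y := fun x y hxy => by
    by_contra hne
    obtain ⟨U, hU, hx, hy⟩ := exists_isClopen_of_totally_separated hne
    obtain ⟨j, S, rfl⟩ := hp U hU
    exact hy (by simpa [hxy j] using hx)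
  have hpreg : ∀ j (S : Set (P j).ι), g ⁻¹' ((P j).q ⁻¹' S) = (P j).p ⁻¹' S := fun j S => by
    ext x
    simp [hg]
  have hpreh : ∀ j (S : Set (P j).ι), h ⁻¹' ((P j).p ⁻¹' S) = (P j).q ⁻¹' S := fun j S => by
    ext x
    simp [hh]
  let k : X ≃ₜ X :=
    { toFun := g
      invFun := h
      left_inv := fun x => hsepp _ _ fun j => by rw [hh, hg]
      right_inv := fun x => hsepq _ _ fun j => by rw [hg, hh]
      continuous_toFun := isTopologicalBasis_isClopen.continuous_iff.2 fun U hU => by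
        obtain ⟨j, S, rfl⟩ := hq U hU
        rw [hpreg]
        exact (P j).hp S
      continuous_invFun := isTopologicalBasis_isClopen.continuous_iff.2 fun U hU => by
        obtain ⟨j, S, rfl⟩ := hp U hU
        rw [hpreh]
        exact (P j).hq S }
  refine ⟨⟨k, homeomorph_measurePreserving k fun U hU => ?_⟩, fun j x => hg x j⟩
  obtain ⟨j, S, rfl⟩ := hq U hU
  change μ.real (g ⁻¹' ((P j).q ⁻¹' S)) = _
  rw [hpreg, measureReal_preimage_eq_sum (P j).hp, measureReal_preimage_eq_sum (P j).hq]
  simp only [(P j).meas_eq]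

/-- The back-and-forth construction of measure-preserving homeomorphisms, with countably many
additional requirements. -/
theorem exists_homeo_of_backAndForth [IsFiniteMeasure μ] [μ.IsOpenPosMeasure]
    (Q : PartitionPair μ → Prop)
    (forth : ∀ P, Q P → ∀ U, IsClopen U → ∃ P', P ≤ P' ∧ Q P' ∧ ∃ S, U = P'.p ⁻¹' S)
    (back : ∀ P, Q P → ∀ U, IsClopen U → ∃ P', P ≤ P' ∧ Q P' ∧ ∃ S, U = P'.q ⁻¹' S)
    {κ : Type*} [Countable κ] (D : κ → Set (PartitionPair μ))
    (hD : ∀ k P, Q P → ∃ P', P ≤ P' ∧ Q P' ∧ P' ∈ D k) (P₀ : PartitionPair μ) (hP₀ : Q P₀) :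
    ∃ g : homeoPreserving μ, (∀ x, P₀.q (g.1 x) = P₀.p x) ∧
      (∀ U, IsClopen U → ∃ P, Q P ∧ (∃ S, U = P.q ⁻¹' S) ∧ ∀ x, P.q (g.1 x) = P.p x) ∧
      ∀ k, ∃ P ∈ D k, Q P ∧ ∀ x, P.q (g.1 x) = P.p x := by
  have : Countable (TopologicalSpace.Clopens X) :=
    TopologicalSpace.Clopens.countable_iff_secondCountable.2 inferInstance
  let _ : Encodable ((TopologicalSpace.Clopens X ⊕ TopologicalSpace.Clopens X) ⊕ κ) :=
    Encodable.ofCountable _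
  let 𝒟 : (TopologicalSpace.Clopens X ⊕ TopologicalSpace.Clopens X) ⊕ κ →
      Order.Cofinal {P : PartitionPair μ // Q P} := fun k =>
    { carrier := {P | Sum.elim (Sum.elim
        (fun U : TopologicalSpace.Clopens X => ∃ S, (U : Set X) = P.1.p ⁻¹' S)
        (fun U : TopologicalSpace.Clopens X => ∃ S, (U : Set X) = P.1.q ⁻¹' S))
        (fun k => P.1 ∈ D k) k}
      isCofinal := fun P => by
        rcases k with (U | U) | k
        · obtain ⟨P', hle, hQ, h⟩ := forth P.1 P.2 U U.isClopen
          exact ⟨⟨P', hQ⟩, h, hle⟩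
        · obtain ⟨P', hle, hQ, h⟩ := back P.1 P.2 U U.isClopen
          exact ⟨⟨P', hQ⟩, h, hle⟩
        · obtain ⟨P', hle, hQ, h⟩ := hD k P.1 P.2
          exact ⟨⟨P', hQ⟩, h, hle⟩ }
  -- Rasiowa–Sikorski: an ideal through `P₀` meeting the countably many cofinal sets is the required
  -- directed system.
  let I := Order.idealOfCofinals ⟨P₀, hP₀⟩ 𝒟
  have hmeet := Order.cofinal_meets_idealOfCofinals ⟨P₀, hP₀⟩ 𝒟
  have : Nonempty I := ⟨⟨_, Order.mem_idealOfCofinals _ _⟩⟩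
  obtain ⟨g, hg⟩ := exists_homeo_of_directed (fun P : I => P.1.1)
    (fun P P' => by
      obtain ⟨P'', h, h1, h2⟩ := I.directed P.1 P.2 P'.1 P'.2
      exact ⟨⟨P'', h⟩, h1, h2⟩)
    (fun U hU => by
      obtain ⟨P, ⟨S, hS⟩, hP⟩ := hmeet (.inl (.inl ⟨U, hU⟩))
      exact ⟨⟨P, hP⟩, S, hS⟩)
    (fun U hU => by
      obtain ⟨P, ⟨S, hS⟩, hP⟩ := hmeet (.inl (.inr ⟨U, hU⟩))
      exact ⟨⟨P, hP⟩, S, hS⟩)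
  refine ⟨g, hg ⟨_, Order.mem_idealOfCofinals _ _⟩, fun U hU => ?_, fun k => ?_⟩
  · obtain ⟨P, hS, hP⟩ := hmeet (.inl (.inr ⟨U, hU⟩))
    exact ⟨P.1, P.2, hS, hg ⟨P, hP⟩⟩
  · obtain ⟨P, hk, hP⟩ := hmeet (.inr k)
    exact ⟨P.1, hk, P.2, hg ⟨P, hP⟩⟩

end BackAndForth

theorem isLocallyConstant_mem {X : Type*} [TopologicalSpace X] {U : Set X} (hU : IsClopen U) :
    IsLocallyConstant fun x => x ∈ U := by
  refine IsLocallyConstant.iff_isOpen_fiber.2 fun P => ?_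
  by_cases hP : P
  · convert hU.isOpen using 1
    ext x
    simp [hP]
  · convert hU.compl.isOpen using 1
    ext x
    simp [hP]

/-! ### Good measures: copying partitions, and the topology of `H_μ`. -/

section GoodMeasure

variable {X : Type v} [TopologicalSpace X] [MeasurableSpace X] {μ : Measure X}

theorem measureReal_mem_clopenValueSet {κ : Type*} {q : X → κ} (hq : IsLocallyConstant q)
    (k : κ) : μ.real (q ⁻¹' {k}) ∈ clopenValueSet μ :=
  ⟨_, hq.isClopen_fiber k, rfl⟩

variable [BorelSpace X]

/-- Goodness cuts off one clopen piece at a time. When no weights remain, the rest is null and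
clopen, hence empty by full support. -/
theorem IsGoodMeasure.exists_split (hμ : IsGoodMeasure μ) {κ : Type*} [Nonempty κ] (s : Finset κ)
    (w : κ → ℝ) (hw : ∀ k, w k ∈ clopenValueSet μ) (B : Set X) (hB : IsClopen B)
    (h : ∑ k ∈ s, w k = μ.real B) :
    ∃ q : X → κ, (∀ x ∈ B, q x ∈ s) ∧
      ∀ k ∈ s, IsClopen (B ∩ q ⁻¹' {k}) ∧ μ.real (B ∩ q ⁻¹' {k}) = w k := by
  classical
  have := hμ.prob
  have := hμ.fullSupport
  induction s using Finset.induction_on generalizing B with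
  | empty =>
    obtain ⟨k⟩ := ‹Nonempty κ›
    refine ⟨fun _ => k, fun x hx => ?_, by simp⟩
    have := measureReal_pos_of_isOpen (μ := μ) hB.isOpen ⟨x, hx⟩
    rw [← h, Finset.sum_empty] at this
    exact (lt_irrefl _ this).elim
  | insert a s ha ih =>
    rw [Finset.sum_insert ha] at h
    obtain ⟨A, hA, hAw⟩ := hw a
    have hnn : ∀ k, 0 ≤ w k := fun k => by
      obtain ⟨_, _, h⟩ := hw k
      exact h ▸ ENNReal.toReal_nonneg
    have hs : 0 ≤ ∑ k ∈ s, w k := Finset.sum_nonneg fun k _ => hnn k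
    have hle : μ A ≤ μ B := by
      rw [← ENNReal.toReal_le_toReal (measure_ne_top μ A) (measure_ne_top μ B), hAw]
      change _ ≤ μ.real B
      linarith
    obtain ⟨C, hC, hCB, hCA⟩ := hμ.good A B hA hB hle
    have hCw : μ.real C = w a := by rw [measureReal_def, hCA, hAw]
    obtain ⟨q, hq, hqs⟩ := ih (B \ C) (hB.diff hC) (by
      rw [measureReal_sdiff hCB hC.isOpen.measurableSet, hCw]
      linarith)
    have hfib : ∀ k ∈ s, B ∩ C.piecewise (fun _ => a) q ⁻¹' {k} = (B \ C) ∩ q ⁻¹' {k} := by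
      intro k hk
      have hak : a ≠ k := fun h => ha (h ▸ hk)
      ext x
      by_cases hx : x ∈ C <;> simp [hx, hak]
    have hfib' : B ∩ C.piecewise (fun _ => a) q ⁻¹' {a} = C := by
      ext x
      by_cases hx : x ∈ C
      · simp [hx, hCB hx]
      · simp only [mem_inter_iff, mem_preimage, piecewise_eq_of_notMem _ _ _ hx,
          mem_singleton_iff, hx, iff_false, not_and]
        rintro hxB rfl
        exact ha (hq x ⟨hxB, hx⟩)
    refine ⟨C.piecewise (fun _ => a) q, fun x hx => ?_, fun k hk => ?_⟩
    · by_cases hxC : x ∈ C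
      · simp [hxC]
      · simpa [hxC] using Or.inr (hq x ⟨hx, hxC⟩)
    · rcases Finset.mem_insert.1 hk with rfl | hk
      · rw [hfib']
        exact ⟨hC, hCw⟩
      · rw [hfib k hk]
        exact hqs k hk

/-- Every refinement of the weights of a clopen partition is realised by a clopen refinement. -/
theorem IsGoodMeasure.exists_refinement (hμ : IsGoodMeasure μ) {ι κ : Type*} [Finite ι] [Fintype κ]
    {p : X → ι} (hp : IsLocallyConstant p) (f : κ → ι) (w : κ → ℝ)
    (hw : ∀ k, w k ∈ clopenValueSet μ) (h : ∀ i, pushWeight f w i = μ.real (p ⁻¹' {i})) :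
    ∃ q : X → κ, IsLocallyConstant q ∧ (∀ x, f (q x) = p x) ∧ ∀ k, μ.real (q ⁻¹' {k}) = w k := by
  classical
  have := hμ.prob
  have := hμ.fullSupport
  have hκ : Nonempty κ := by
    by_contra hκ
    rw [not_nonempty_iff] at hκ
    obtain ⟨x, -⟩ := nonempty_of_measure_ne_zero (μ := μ) (s := univ) (by simp)
    have h1 := measureReal_pos_of_isOpen (μ := μ) (hp.isOpen_fiber (p x)) ⟨x, rfl⟩
    change 0 < μ.real (p ⁻¹' {p x}) at h1
    rw [← h] at h1
    simp [pushWeight] at h1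
  have key := fun i => hμ.exists_split (Finset.univ.filter fun k => f k = i) w hw (p ⁻¹' {i})
    ⟨(hp.isClosed_fiber i), hp.isOpen_fiber i⟩
    (by rw [← h i, pushWeight, Finset.sum_filter])
  choose q hq hqs using key
  have hfq : ∀ x, f (q (p x) x) = p x := fun x => by simpa using hq (p x) x rfl
  have hfib : ∀ k, (fun x => q (p x) x) ⁻¹' {k} = p ⁻¹' {f k} ∩ q (f k) ⁻¹' {k} := fun k => by
    ext x
    simp only [mem_preimage, mem_singleton_iff, mem_inter_iff]
    constructor
    · rintro rfl
      rw [hfq]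
      exact ⟨rfl, rfl⟩
    · rintro ⟨h1, h2⟩
      rw [h1, h2]
  refine ⟨fun x => q (p x) x, IsLocallyConstant.iff_isOpen_fiber.2 fun k => ?_, hfq, fun k => ?_⟩
  · rw [hfib]
    exact ((hqs (f k) k (by simp)).1).isOpen
  · rw [hfib]
    exact (hqs (f k) k (by simp)).2

/-- A refinement of one side of a pair of partitions can be copied to the other side. -/
theorem IsGoodMeasure.exists_le (hμ : IsGoodMeasure μ) (P : PartitionPair μ) {κ : Type}
    [Fintype κ] {r : X → κ} (hr : IsLocallyConstant r) {f : κ → P.ι} (hf : ∀ x, f (r x) = P.p x) :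
    ∃ r' : X → κ, IsLocallyConstant r' ∧ (∀ x, f (r' x) = P.q x) ∧
      ∀ k, μ.real (r ⁻¹' {k}) = μ.real (r' ⁻¹' {k}) := by
  have := hμ.prob
  obtain ⟨r', h1, h2, h3⟩ := hμ.exists_refinement P.hq f (fun k => μ.real (r ⁻¹' {k}))
    (fun k => measureReal_mem_clopenValueSet hr k) fun i => by
      rw [pushWeight_measureReal hr, ← P.meas_eq, show f ∘ r = P.p from funext hf]
  exact ⟨r', h1, h2, fun k => (h3 k).symm⟩

theorem IsGoodMeasure.exists_forth (hμ : IsGoodMeasure μ) (P : PartitionPair μ) {U : Set X}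
    (hU : IsClopen U) : ∃ P', P ≤ P' ∧ ∃ S, U = P'.p ⁻¹' S := by
  classical
  obtain ⟨r', h1, h2, h3⟩ := hμ.exists_le P (P.hp.prodMk (isLocallyConstant_mem hU))
    (f := Prod.fst) fun x => rfl
  exact ⟨⟨P.ι × Prop, _, r', P.hp.prodMk (isLocallyConstant_mem hU), h1, h3⟩,
    ⟨Prod.fst, rfl, funext h2⟩, {k | k.2}, rfl⟩

theorem IsGoodMeasure.exists_back (hμ : IsGoodMeasure μ) (P : PartitionPair μ) {U : Set X}
    (hU : IsClopen U) : ∃ P', P ≤ P' ∧ ∃ S, U = P'.q ⁻¹' S := by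
  obtain ⟨P', h, hS⟩ := hμ.exists_forth P.swap hU
  exact ⟨P'.swap, PartitionPair.swap_le_swap h, hS⟩

theorem isOpen_setOf_comp_eq {κ : Type*} [Finite κ] {p q : X → κ} (hp : IsLocallyConstant p)
    (hq : IsLocallyConstant q) : IsOpen {g : homeoPreserving μ | ∀ x, p (g.1 x) = q x} := by
  have h : {g : homeoPreserving μ | ∀ x, p (g.1 x) = q x} =
      ⋂ i, Subtype.val ⁻¹' {g : X ≃ₜ X | g '' (q ⁻¹' {i}) = p ⁻¹' {i}} := by
    ext g
    simp only [mem_ofPred_eq, mem_iInter, mem_preimage]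
    constructor
    · intro h i
      have : q ⁻¹' {i} = g.1 ⁻¹' (p ⁻¹' {i}) := by
        ext x
        simp [h]
      rw [this, image_preimage_eq _ g.1.surjective]
    · intro h x
      have : g.1 x ∈ p ⁻¹' {q x} := by
        rw [← h (q x)]
        exact mem_image_of_mem _ rfl
      exact this
  rw [h]
  exact isOpen_iInter_of_finite fun i => continuous_subtype_val.isOpen_preimage _
    (TopologicalSpace.isOpen_generateFrom_of_mem
      ⟨_, _, hq.isClopen_fiber i, hp.isClopen_fiber i, rfl⟩)

/-- With `isOpen_setOf_comp_eq` this shows that agreement with `g₀` after a finite clopen partition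
gives a neighbourhood base at `g₀`. -/
theorem exists_partition_of_isOpen {O : Set (homeoPreserving μ)} (hO : IsOpen O)
    {g₀ : homeoPreserving μ} (hg₀ : g₀ ∈ O) :
    ∃ (κ : Type) (_ : Fintype κ) (p : X → κ), IsLocallyConstant p ∧
      ∀ g : homeoPreserving μ, (∀ x, p (g.1 x) = p (g₀.1 x)) → g ∈ O := by
  classical
  obtain ⟨O', hO', rfl⟩ := isOpen_induced_iff.1 hO
  induction hO' with
  | basic S hS =>
    obtain ⟨U, W, hU, hW, rfl⟩ := hS
    refine ⟨Prop, inferInstance, fun x => x ∈ W, isLocallyConstant_mem hW, fun g hg => ?_⟩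
    have h0 : g₀.1 '' U = W := hg₀
    change g.1 '' U = W
    have h1 : U = g₀.1 ⁻¹' W := by rw [← h0, preimage_image_eq _ g₀.1.injective]
    have h2 : g.1 ⁻¹' W = g₀.1 ⁻¹' W := by
      ext x
      exact iff_of_eq (hg x)
    rw [h1, ← h2, image_preimage_eq _ g.1.surjective]
  | univ => exact ⟨Unit, inferInstance, fun _ => (), IsLocallyConstant.const _, fun _ _ => trivial⟩
  | inter s t hs ht ihs iht =>
    obtain ⟨κ, _, p, hp, h⟩ := ihs (continuous_subtype_val.isOpen_preimage _ hs) hg₀.1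
    obtain ⟨κ', _, p', hp', h'⟩ := iht (continuous_subtype_val.isOpen_preimage _ ht) hg₀.2
    refine ⟨κ × κ', inferInstance, _, hp.prodMk hp', fun g hg => ⟨h g fun x => ?_, h' g fun x => ?_⟩⟩
    exacts [congrArg Prod.fst (hg x), congrArg Prod.snd (hg x)]
  | sUnion S hS ih =>
    obtain ⟨s, hs, hg⟩ := hg₀
    obtain ⟨κ, _, p, hp, h⟩ := ih s hs (continuous_subtype_val.isOpen_preimage _ (hS s hs)) hg
    exact ⟨κ, ‹_›, p, hp, fun g hg => ⟨s, hs, h g hg⟩⟩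

variable [CompactSpace X] [T2Space X] [TotallyDisconnectedSpace X] [SecondCountableTopology X]

/-- Homogeneity: partitions with the same weights are conjugate. -/
theorem IsGoodMeasure.exists_homeo (hμ : IsGoodMeasure μ) (P : PartitionPair μ) :
    ∃ g : homeoPreserving μ, ∀ x, P.q (g.1 x) = P.p x := by
  have := hμ.prob
  have := hμ.fullSupport
  obtain ⟨g, hg, -⟩ := exists_homeo_of_backAndForth (μ := μ) (fun _ => True)
    (fun P _ U hU => by
      obtain ⟨P', h, hS⟩ := hμ.exists_forth P hU
      exact ⟨P', h, trivial, hS⟩)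
    (fun P _ U hU => by
      obtain ⟨P', h, hS⟩ := hμ.exists_back P hU
      exact ⟨P', h, trivial, hS⟩)
    (κ := Empty) Empty.elim (fun k => k.elim) P trivial
  exact ⟨g, hg⟩

/-- `H_μ` is a Baire space. -/
theorem IsGoodMeasure.baireSpace (hμ : IsGoodMeasure μ) : BaireSpace (homeoPreserving μ) := by
  have := hμ.prob
  have := hμ.fullSupport
  refine ⟨fun O hO hd => dense_iff_inter_open.2 fun O₀ hO₀ ⟨g₀, hg₀⟩ => ?_⟩
  obtain ⟨κ, _, p₀, hp₀, h₀⟩ := exists_partition_of_isOpen hO₀ hg₀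
  have hcomp : ∀ (g : homeoPreserving μ) {κ : Type} {p : X → κ}, IsLocallyConstant p →
      IsLocallyConstant fun x => p (g.1 x) := fun g _ _ hp => hp.comp_continuous g.1.continuous
  have hmeas : ∀ (g : homeoPreserving μ) {κ : Type} {p : X → κ}, IsLocallyConstant p → ∀ i,
      μ.real ((fun x => p (g.1 x)) ⁻¹' {i}) = μ.real (p ⁻¹' {i}) := fun g _ p hp i =>
    MeasurePreserving.measureReal_preimage g.2 (hp.isOpen_fiber i).measurableSet.nullMeasurableSet
  obtain ⟨g, hg, -, hgD⟩ := exists_homeo_of_backAndForth (μ := μ) (fun _ => True)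
    (fun P _ U hU => by
      obtain ⟨P', h, hS⟩ := hμ.exists_forth P hU
      exact ⟨P', h, trivial, hS⟩)
    (fun P _ U hU => by
      obtain ⟨P', h, hS⟩ := hμ.exists_back P hU
      exact ⟨P', h, trivial, hS⟩)
    -- The pairs that already force membership in `O n`. They are cofinal: homogeneity makes the
    -- open set defined by `P` nonempty, so it meets `O n` in some `g₂`, and a fine enough partition
    -- with its pullback under `g₂` is such a pair.
    (fun n => {P | ∀ g : homeoPreserving μ, (∀ x, P.q (g.1 x) = P.p x) → g ∈ O n})
    (fun n P _ => by
      obtain ⟨g₁, hg₁⟩ := hμ.exists_homeo P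
      obtain ⟨g₂, hg₂, hg₂O⟩ := dense_iff_inter_open.1 (hd n) _ (isOpen_setOf_comp_eq P.hq P.hp)
        ⟨g₁, hg₁⟩
      obtain ⟨κ, _, p, hp, h⟩ := exists_partition_of_isOpen (hO n) hg₂O
      have hr := P.hq.prodMk hp
      refine ⟨⟨P.ι × κ, _, _, hcomp g₂ hr, hr, hmeas g₂ hr⟩, ⟨Prod.fst, funext hg₂, rfl⟩, trivial,
        fun g hg => h g fun x => congrArg Prod.snd (hg x)⟩)
    ⟨κ, _, _, hcomp g₀ hp₀, hp₀, hmeas g₀ hp₀⟩ trivial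
  refine ⟨g, h₀ g hg, mem_iInter.2 fun n => ?_⟩
  obtain ⟨P, hP, -, hPg⟩ := hgD n
  exact hP g hPg

end GoodMeasure

section Weights

variable {ι κ : Type*}

theorem le_pushWeight [Fintype κ] (f : κ → ι) {w : κ → ℝ} (hw : ∀ k, 0 ≤ w k) (k : κ) :
    w k ≤ pushWeight f w (f k) := by
  classical
  unfold pushWeight
  refine le_trans (by simp) (Finset.single_le_sum (f := fun l => if f l = f k then w l else 0)
    (fun l _ => ?_) (Finset.mem_univ k))
  split_ifs
  exacts [hw l, le_rfl]

theorem pushWeight_fst [Fintype ι] [Fintype κ] (w : ι × κ → ℝ) (i : ι) :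
    pushWeight Prod.fst w i = ∑ k, w (i, k) := by
  classical
  unfold pushWeight
  rw [Fintype.sum_prod_type, Finset.sum_eq_single i (fun b' _ hb => by simp [hb]) (by simp)]
  simp

theorem pushWeight_snd [Fintype ι] [Fintype κ] (w : ι × κ → ℝ) (k : κ) :
    pushWeight Prod.snd w k = ∑ i, w (i, k) := by
  classical
  unfold pushWeight
  rw [Fintype.sum_prod_type_right, Finset.sum_eq_single k (fun b' _ hb => by simp [hb]) (by simp)]
  simp

theorem pushWeight_congr {ι' κ' : Type*} [Fintype κ] [Fintype κ'] (e : ι ≃ ι') (e' : κ ≃ κ')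
    (f : κ → ι) (w : κ → ℝ) (i : ι') :
    pushWeight (e ∘ f ∘ e'.symm) (w ∘ e'.symm) i = pushWeight f w (e.symm i) := by
  classical
  unfold pushWeight
  rw [← Equiv.sum_comp e'.symm]
  refine Finset.sum_congr rfl fun k _ => ?_
  simp [e.eq_symm_apply]

end Weights

theorem surjective_of_measureReal_pos {X κ : Type*} [MeasurableSpace X] {μ : Measure X} {q : X → κ}
    (h : ∀ k, 0 < μ.real (q ⁻¹' {k})) : Function.Surjective q := fun k => by
  by_contra hk
  have : q ⁻¹' {k} = ∅ := by
    ext x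
    simpa using fun hx => hk ⟨x, hx⟩
  have h1 := h k
  rw [this, measureReal_empty] at h1
  exact lt_irrefl _ h1

theorem countable_isLocallyConstant {X : Type*} [TopologicalSpace X]
    [CompactSpace X] [T2Space X]
    [TotallyDisconnectedSpace X] [SecondCountableTopology X] (n : ℕ) :
    Countable {p : X → Fin n // IsLocallyConstant p} := by
  have : Countable (TopologicalSpace.Clopens X) :=
    TopologicalSpace.Clopens.countable_iff_secondCountable.2 inferInstance
  refine Function.Injective.countable
    (f := fun p (i : Fin n) => (⟨p.1 ⁻¹' {i}, p.2.isClopen_fiber i⟩ : TopologicalSpace.Clopens X))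
    fun p q h => Subtype.ext (funext fun x => ?_)
  have h1 : p.1 ⁻¹' {p.1 x} = q.1 ⁻¹' {p.1 x} :=
    congrArg (fun U : TopologicalSpace.Clopens X => (U : Set X)) (congrFun h (p.1 x))
  have h2 : x ∈ q.1 ⁻¹' {p.1 x} := h1 ▸ rfl
  exact h2.symm

/-! ### Generic homeomorphisms. -/

section Generic

variable {X : Type v} [TopologicalSpace X] [MeasurableSpace X] {μ : Measure X}

/-- `p` is refined by a finite partition which is permuted by `g`. -/
def InvariantlyRefined (g : X ≃ₜ X) {ι : Type} (p : X → ι) : Prop :=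
  ∃ (κ : Type) (_ : Fintype κ) (q : X → κ) (τ : Equiv.Perm κ) (f : κ → ι),
    IsLocallyConstant q ∧ Function.Surjective q ∧ (∀ x, q (g x) = τ (q x)) ∧ ∀ x, f (q x) = p x

variable (μ) in
/-- The extension `f` of finite weighted dynamical systems is realised over the factor `p`
of `g`. -/
def ExtensionRealized (g : X ≃ₜ X) {ι κ : Type} (p : X → ι) (f : κ → ι) (τ : Equiv.Perm κ)
    (w : κ → ℝ) : Prop :=
  ∃ q : X → κ, IsLocallyConstant q ∧ (∀ x, f (q x) = p x) ∧ (∀ k, μ.real (q ⁻¹' {k}) = w k) ∧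
    ∀ x, q (g x) = τ (q x)

variable (μ) in
/-- `κ` with its permutation `τ` and its weights `w` is an extension of the partition `p` and the
permutation `σ` of its index set. -/
structure IsExtension {ι κ : Type} [Fintype κ] (p : X → ι) (σ : Equiv.Perm ι) (f : κ → ι)
    (τ : Equiv.Perm κ) (w : κ → ℝ) : Prop where
  mem : ∀ k, w k ∈ clopenValueSet μ
  pos : ∀ k, 0 < w k
  inv : ∀ k, w (τ k) = w k
  map_perm : ∀ k, f (τ k) = σ (f k)
  push : ∀ i, pushWeight f w i = μ.real (p ⁻¹' {i})

variable (μ) in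
/-- A homeomorphism is generic if its finite factors capture all clopen sets and satisfy the
extension property. -/
structure IsGenericHomeo (g : X ≃ₜ X) : Prop where
  refined : ∀ (n : ℕ) (p : X → Fin n), IsLocallyConstant p → InvariantlyRefined g p
  realized : ∀ (n m : ℕ) (p : X → Fin n) (σ : Equiv.Perm (Fin n)) (f : Fin m → Fin n)
    (τ : Equiv.Perm (Fin m)) (w : Fin m → ℝ), IsLocallyConstant p → IsExtension μ p σ f τ w →
    (∀ x, p (g x) = σ (p x)) → ExtensionRealized μ g p f τ w

/-- Genericity only mentions `Fin n`, which keeps the conditions countable; relabelling gives all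
finite index types. -/
theorem IsGenericHomeo.invariantlyRefined {g : X ≃ₜ X} (hg : IsGenericHomeo μ g) {ι : Type}
    [Finite ι] {p : X → ι} (hp : IsLocallyConstant p) : InvariantlyRefined g p := by
  obtain ⟨n, ⟨e⟩⟩ := Finite.exists_equiv_fin ι
  obtain ⟨κ, i, q, τ, f, hq, hs, hτ, hf⟩ := hg.refined n (e ∘ p) (hp.comp e)
  exact ⟨κ, i, q, τ, e.symm ∘ f, hq, hs, hτ, fun x => by simp [hf]⟩

theorem IsGenericHomeo.extensionRealized {g : X ≃ₜ X} (hg : IsGenericHomeo μ g) {ι κ : Type}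
    [Finite ι] [Fintype κ] {p : X → ι} (hp : IsLocallyConstant p) {σ : Equiv.Perm ι} {f : κ → ι}
    {τ : Equiv.Perm κ} {w : κ → ℝ} (h : IsExtension μ p σ f τ w)
    (hσ : ∀ x, p (g x) = σ (p x)) : ExtensionRealized μ g p f τ w := by
  obtain ⟨n, ⟨e⟩⟩ := Finite.exists_equiv_fin ι
  obtain ⟨m, ⟨e'⟩⟩ := Finite.exists_equiv_fin κ
  obtain ⟨q, hq, hf, hw, hτ⟩ := hg.realized n m (e ∘ p) (e.permCongr σ) (e ∘ f ∘ e'.symm)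
    (e'.permCongr τ) (w ∘ e'.symm) (hp.comp e)
    { mem := fun k => h.mem _
      pos := fun k => h.pos _
      inv := fun k => by simp [h.inv]
      map_perm := fun k => by simp [h.map_perm]
      push := fun i => by
        rw [pushWeight_congr, h.push, preimage_comp]
        congr 2
        ext x
        simp [e.eq_symm_apply] }
    fun x => by simp [hσ]
  refine ⟨e'.symm ∘ q, hq.comp e'.symm, fun x => ?_, fun k => ?_, fun x => by simp [hτ]⟩
  · have := hf x
    simpa using this
  · have := hw (e' k)
    rw [preimage_comp, show e'.symm ⁻¹' {k} = {e' k} by ext; simp [Equiv.symm_apply_eq], this]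
    simp

/-- Pairs of invariant partitions which are permuted in the same way. -/
structure PartitionPair.Intertwines (g h : X ≃ₜ X) (P : PartitionPair μ) : Prop where
  surj_p : Function.Surjective P.p
  surj_q : Function.Surjective P.q
  exists_perm : ∃ σ : Equiv.Perm P.ι, (∀ x, P.p (g x) = σ (P.p x)) ∧ ∀ x, P.q (h x) = σ (P.q x)

theorem PartitionPair.Intertwines.swap {g h : X ≃ₜ X} {P : PartitionPair μ}
    (hP : P.Intertwines g h) : P.swap.Intertwines h g :=
  ⟨hP.surj_q, hP.surj_p, hP.exists_perm.imp fun _ h => ⟨h.2, h.1⟩⟩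

variable [BorelSpace X]

theorem measureReal_preimage_homeo (g : homeoPreserving μ) {κ : Type*} {p : X → κ}
    (hp : IsLocallyConstant p) (i : κ) :
    μ.real ((fun x => p (g.1 x)) ⁻¹' {i}) = μ.real (p ⁻¹' {i}) :=
  MeasurePreserving.measureReal_preimage g.2 (hp.isOpen_fiber i).measurableSet.nullMeasurableSet

/-- A finite factor of `g` refining both `P.p` and `U` is an extension of the factor `P.q` of `h`,
so genericity of `h` realises a copy of it. -/
theorem PartitionPair.Intertwines.exists_forth [IsFiniteMeasure μ] [μ.IsOpenPosMeasure]
    {g h : homeoPreserving μ} (hg : IsGenericHomeo μ g.1) (hh : IsGenericHomeo μ h.1)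
    {P : PartitionPair μ} (hP : P.Intertwines g.1 h.1) {U : Set X} (hU : IsClopen U) :
    ∃ P', P ≤ P' ∧ P'.Intertwines g.1 h.1 ∧ ∃ S, U = P'.p ⁻¹' S := by
  obtain ⟨σ, hσg, hσh⟩ := hP.exists_perm
  obtain ⟨κ, _, r, τ, f, hr, hrs, hτ, hf⟩ :=
    hg.invariantlyRefined (P.hp.prodMk (isLocallyConstant_mem hU))
  have hf1 : ∀ x, (f (r x)).1 = P.p x := fun x => congrArg Prod.fst (hf x)
  have hw : ∀ k, 0 < μ.real (r ⁻¹' {k}) := fun k => by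
    obtain ⟨x, rfl⟩ := hrs k
    exact measureReal_pos_of_isOpen (hr.isOpen_fiber _) ⟨x, rfl⟩
  obtain ⟨r', hr', hf', hw', hτ'⟩ := hh.extensionRealized (κ := κ) P.hq (σ := σ)
    (f := Prod.fst ∘ f) (τ := τ) (w := fun k => μ.real (r ⁻¹' {k}))
    { mem := measureReal_mem_clopenValueSet hr
      pos := hw
      inv := fun k => by
        rw [← measureReal_preimage_homeo g hr (τ k)]
        congr 1
        ext x
        simp [hτ]
      map_perm := fun k => by
        obtain ⟨x, rfl⟩ := hrs k
        rw [← hτ]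
        simp only [Function.comp_apply, hf1, hσg]
      push := fun i => by
        rw [pushWeight_measureReal hr, ← P.meas_eq]
        congr 2
        exact funext hf1 } hσh
  refine ⟨⟨κ, r, r', hr, hr', fun k => (hw' k).symm⟩, ⟨Prod.fst ∘ f, funext hf1, funext hf'⟩,
    ⟨hrs, surjective_of_measureReal_pos (μ := μ) fun k => ?_, τ, hτ, hτ'⟩, {k | (f k).2}, ?_⟩
  · rw [hw']
    exact hw k
  · ext x
    exact iff_of_eq (congrArg Prod.snd (hf x)).symm

theorem PartitionPair.Intertwines.exists_back [IsFiniteMeasure μ] [μ.IsOpenPosMeasure]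
    {g h : homeoPreserving μ} (hg : IsGenericHomeo μ g.1) (hh : IsGenericHomeo μ h.1)
    {P : PartitionPair μ} (hP : P.Intertwines g.1 h.1) {U : Set X} (hU : IsClopen U) :
    ∃ P', P ≤ P' ∧ P'.Intertwines g.1 h.1 ∧ ∃ S, U = P'.q ⁻¹' S := by
  obtain ⟨P', hle, hI, hS⟩ := PartitionPair.Intertwines.exists_forth hh hg hP.swap hU
  exact ⟨P'.swap, PartitionPair.swap_le_swap hle, hI.swap, hS⟩

/-! ### Density and openness of the generic conditions. -/

section Density

variable {V : Set ℝ}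

/-- Every `g₀` can be approximated by homeomorphisms that permute a refinement of a given
partition. -/
theorem IsGoodMeasure.exists_invariantlyRefined [CompactSpace X] [T2Space X]
    [TotallyDisconnectedSpace X] [SecondCountableTopology X] (hμ : IsGoodMeasure μ)
    (hV : GroupLikeSet V) (hVμ : clopenValueSet μ = V) (g₀ : homeoPreserving μ)
    {ι : Type} [Fintype ι] {p : X → ι} (hp : IsLocallyConstant p) :
    ∃ g : homeoPreserving μ, (∀ x, p (g.1 x) = p (g₀.1 x)) ∧ InvariantlyRefined g.1 p := by
  have := hμ.prob
  have hp' : IsLocallyConstant fun x => p (g₀.1 x) := hp.comp_continuous g₀.1.continuous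
  have hr := hp.prodMk hp'
  set r : X → ι × ι := fun x => (p x, p (g₀.1 x))
  have hmemG : ∀ k, μ.real (r ⁻¹' {k}) ∈ AddSubgroup.closure (V ∪ {1}) := fun k =>
    (hV.mem_iff.1 (hVμ ▸ measureReal_mem_clopenValueSet hr k)).1
  -- Entry `(i, j)` is the mass that `g₀` moves from piece `i` to piece `j`; it is balanced because
  -- `g₀` preserves `μ`.
  obtain ⟨E, _, t, σ, s, ht, htG, hσ, hs, hsum⟩ := exists_perm_of_balanced
    (AddSubgroup.closure (V ∪ {1})) (fun i j => μ.real (r ⁻¹' {(i, j)}))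
    (fun i j => measureReal_nonneg) (fun i j => hmemG _) fun i => by
      rw [← pushWeight_fst (fun k => μ.real (r ⁻¹' {k})),
        ← pushWeight_snd (fun k => μ.real (r ⁻¹' {k})), pushWeight_measureReal hr,
        pushWeight_measureReal hr]
      exact (measureReal_preimage_homeo g₀ hp i).symm
  have htV : ∀ e, t e ∈ clopenValueSet μ := fun e => by
    rw [hVμ, hV.mem_iff]
    refine ⟨htG e, (ht e).le, (le_pushWeight s (fun e => (ht e).le) e).trans ?_⟩
    rw [show s e = ((s e).1, (s e).2) from rfl, hsum]
    exact measureReal_le_one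
  obtain ⟨q, hq, hqs, hqt⟩ := hμ.exists_refinement hr s t htV fun k => hsum k.1 k.2
  -- `g` carries piece `e` onto piece `σ e`, which starts where `e` ends; so `g` moves the pieces of
  -- `p` as `g₀` does.
  obtain ⟨g, hg⟩ := hμ.exists_homeo ⟨E, σ ∘ q, q, hq.comp σ, hq, fun e => by
    rw [preimage_comp, show σ ⁻¹' {e} = {σ.symm e} by ext; simp [Equiv.eq_symm_apply], hqt, hqt,
      ← hσ, Equiv.apply_symm_apply]⟩
  have hg : ∀ x, q (g.1 x) = σ (q x) := hg
  refine ⟨g, fun x => ?_, E, ‹_›, q, σ, fun e => (s e).1, hq,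
    surjective_of_measureReal_pos (μ := μ) fun e => by rw [hqt]; exact ht e, hg, fun x =>
      congrArg Prod.fst (hqs x)⟩
  have h1 : p (g.1 x) = (s (q (g.1 x))).1 := by rw [hqs]
  rw [h1, hg, hs, hqs]

/-- Every `g₀` can be approximated by homeomorphisms that realise a given extension. -/
theorem IsGoodMeasure.exists_extensionRealized [CompactSpace X] [T2Space X]
    [TotallyDisconnectedSpace X] [SecondCountableTopology X] (hμ : IsGoodMeasure μ)
    (hV : QLikeSet V) (hVμ : clopenValueSet μ = V) (g₀ : homeoPreserving μ)
    {ι κ ι' : Type} [Fintype ι] [Fintype κ] [Fintype ι'] {p : X → ι} (hp : IsLocallyConstant p)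
    {p' : X → ι'} (hp' : IsLocallyConstant p') {σ : Equiv.Perm ι} {f : κ → ι}
    {τ : Equiv.Perm κ} {w : κ → ℝ} (h : IsExtension μ p σ f τ w)
    (hσ : ∀ x, p (g₀.1 x) = σ (p x)) :
    ∃ g : homeoPreserving μ, (∀ x, p' (g.1 x) = p' (g₀.1 x)) ∧ ExtensionRealized μ g.1 p f τ w := by
  have := hμ.prob
  have := hμ.fullSupport
  have hmem : ∀ x, x ∈ clopenValueSet μ → x ∈ AddSubgroup.closure (V ∪ {1}) := fun x hx =>
    (hV.1.mem_iff.1 (hVμ ▸ hx)).1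
  -- Replace `g₀` by a nearby `g₁` with a finite factor `r` refining `p` and `p'`; the amalgam of
  -- `r` with `κ` over `p` is then a finite coupling problem.
  obtain ⟨g₁, hg₁, β, _, r, ρ, φ, hr, hrs, hρ, hφ⟩ :=
    hμ.exists_invariantlyRefined hV.1 hVμ g₀ (hp.prodMk hp')
  have hφ1 : ∀ x, (φ (r x)).1 = p x := fun x => congrArg Prod.fst (hφ x)
  have hφ2 : ∀ x, (φ (r x)).2 = p' x := fun x => congrArg Prod.snd (hφ x)
  obtain ⟨W, hWG, hW0, hWs, hWi, hWr, hWc⟩ := exists_invariant_coupling _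
    (hV.1.qLikeSet_iff.1 hV) (Prod.fst ∘ φ) f (fun b => μ.real (r ⁻¹' {b})) w
    (fun b => measureReal_nonneg) (fun b => hmem _ (measureReal_mem_clopenValueSet hr b))
    (fun k => (h.pos k).le) (fun k => hmem _ (h.mem k))
    (funext fun i => by
      rw [h.push, pushWeight_measureReal hr]
      congr 2
      exact funext hφ1) σ ρ τ
    (fun b => by
      obtain ⟨x, rfl⟩ := hrs b
      rw [← hρ]
      simp only [Function.comp_apply, hφ1, ← hσ]
      exact congrArg Prod.fst (hg₁ x))
    h.map_perm
    (fun b => by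
      rw [← measureReal_preimage_homeo g₁ hr (ρ b)]
      congr 1
      ext x
      simp [hρ])
    h.inv
  obtain ⟨d, hd, hd1, hdW⟩ := hμ.exists_refinement hr Prod.fst W (fun k => by
      rw [hVμ, hV.1.mem_iff]
      refine ⟨hWG k, hW0 k, (le_pushWeight Prod.fst hW0 k).trans ?_⟩
      rw [pushWeight_fst, hWr]
      exact measureReal_le_one) fun b => by rw [pushWeight_fst, hWr]
  -- `g` permutes the coupled partition by `ρ × τ`: the first coordinate keeps it close to `g₀`, the
  -- second realises the extension.
  obtain ⟨g, hg⟩ := hμ.exists_homeo ⟨β × κ, (ρ.prodCongr τ) ∘ d, d, hd.comp _, hd, fun e => by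
    have : (ρ.prodCongr τ) ⁻¹' {e} = {(ρ.prodCongr τ).symm e} := by
      ext k
      simp [Equiv.eq_symm_apply, -Equiv.prodCongr_symm]
    rw [preimage_comp, this, hdW, hdW, ← hWi]
    congr 1
    exact (ρ.prodCongr τ).apply_symm_apply e⟩
  have hg : ∀ x, d (g.1 x) = (ρ (d x).1, τ (d x).2) := hg
  refine ⟨g, fun x => ?_, fun x => (d x).2, hd.comp Prod.snd, fun x => ?_, fun k => ?_, fun x => ?_⟩
  · rw [← hφ2, ← hd1, hg, hd1, ← hρ, hφ2]
    exact congrArg Prod.snd (hg₁ x)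
  · have h1 := measureReal_pos_of_isOpen (μ := μ) (hd.isOpen_fiber (d x)) ⟨x, rfl⟩
    have h2 : W (d x) ≠ 0 := by
      rw [← hdW]
      exact h1.ne'
    rw [← hWs _ h2, hd1]
    exact hφ1 x
  · rw [← hWc k, ← pushWeight_snd W, show W = fun k => μ.real (d ⁻¹' {k}) from
      funext fun k => (hdW k).symm, pushWeight_measureReal hd]
    rfl
  · exact congrArg Prod.snd (hg x)

theorem isOpen_setOf_invariantlyRefined {ι : Type} (p : X → ι) :
    IsOpen {g : homeoPreserving μ | InvariantlyRefined g.1 p} := by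
  rw [isOpen_iff_forall_mem_open]
  rintro g ⟨κ, _, q, τ, f, hq, hs, hτ, hf⟩
  exact ⟨_, fun g' hg' => ⟨κ, ‹_›, q, τ, f, hq, hs, hg', hf⟩,
    isOpen_setOf_comp_eq hq (hq.comp τ), hτ⟩

theorem isOpen_setOf_extensionRealized {ι κ : Type} [Finite κ] (p : X → ι) (f : κ → ι)
    (τ : Equiv.Perm κ) (w : κ → ℝ) :
    IsOpen {g : homeoPreserving μ | ExtensionRealized μ g.1 p f τ w} := by
  rw [isOpen_iff_forall_mem_open]
  rintro g ⟨q, hq, hf, hw, hτ⟩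
  exact ⟨_, fun g' hg' => ⟨q, hq, hf, hw, hg'⟩, isOpen_setOf_comp_eq hq (hq.comp τ), hτ⟩

/-- Whether `p ∘ g = q` depends only on `p ∘ g`, which is constant near `g`. -/
theorem isOpen_setOf_comp_ne {κ : Type*} [Finite κ] {p q : X → κ} (hp : IsLocallyConstant p) :
    IsOpen {g : homeoPreserving μ | ¬ ∀ x, p (g.1 x) = q x} := by
  rw [isOpen_iff_forall_mem_open]
  intro g hg
  refine ⟨_, fun g' hg' h => hg fun x => ?_,
    isOpen_setOf_comp_eq hp (hp.comp_continuous g.1.continuous), fun x => rfl⟩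
  rw [← h x]
  exact (hg' x).symm

end Density

variable [CompactSpace X] [T2Space X] [TotallyDisconnectedSpace X] [SecondCountableTopology X]
  {V : Set ℝ}

theorem IsGoodMeasure.eventually_isGenericHomeo (hμ : IsGoodMeasure μ)
    (hV : QLikeSet V) (hVμ : clopenValueSet μ = V) :
    ∀ᶠ g in residual (homeoPreserving μ), IsGenericHomeo μ g.1 := by
  classical
  have := countable_isLocallyConstant (X := X)
  have : Countable (clopenValueSet μ) := by
    rw [hVμ]
    exact hV.1.countable.to_subtype
  have h1 : ∀ᶠ g in residual (homeoPreserving μ), ∀ n,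
      ∀ p : {p : X → Fin n // IsLocallyConstant p}, InvariantlyRefined g.1 p.1 := by
    refine eventually_countable_forall.2 fun n => eventually_countable_forall.2 fun p =>
      residual_of_dense_open (isOpen_setOf_invariantlyRefined p.1)
        (dense_iff_inter_open.2 fun O hO ⟨g₀, hg₀⟩ => ?_)
    obtain ⟨κ, _, p', hp', hO'⟩ := exists_partition_of_isOpen hO hg₀
    obtain ⟨g, hg, β, i, q, τ, f, hq, hs, hτ, hf⟩ :=
      hμ.exists_invariantlyRefined hV.1 hVμ g₀ (p.2.prodMk hp')
    exact ⟨g, hO' g fun x => congrArg Prod.snd (hg x),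
      β, i, q, τ, fun k => (f k).1, hq, hs, hτ, fun x => congrArg Prod.fst (hf x)⟩
  have h2 : ∀ᶠ g in residual (homeoPreserving μ), ∀ n m,
      ∀ p : {p : X → Fin n // IsLocallyConstant p}, ∀ (σ : Equiv.Perm (Fin n)) (f : Fin m → Fin n)
      (τ : Equiv.Perm (Fin m)) (w : Fin m → clopenValueSet μ),
      IsExtension μ p.1 σ f τ (fun k => (w k : ℝ)) → (∀ x, p.1 (g.1 x) = σ (p.1 x)) →
      ExtensionRealized μ g.1 p.1 f τ fun k => (w k : ℝ) := by
    refine eventually_countable_forall.2 fun n => eventually_countable_forall.2 fun m =>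
      eventually_countable_forall.2 fun p => eventually_countable_forall.2 fun σ =>
      eventually_countable_forall.2 fun f => eventually_countable_forall.2 fun τ =>
      eventually_countable_forall.2 fun w => eventually_countable_forall.2 fun h => ?_
    -- The implication becomes a union of two open sets. For density, a `g₀` violating the premise
    -- already lies in the union; any other is approximated.
    simp only [imp_iff_not_or]
    refine residual_of_dense_open
      ((isOpen_setOf_comp_ne p.2).union (isOpen_setOf_extensionRealized p.1 f τ _))
      (dense_iff_inter_open.2 fun O hO ⟨g₀, hg₀⟩ => ?_)
    by_cases hσ : ∀ x, p.1 (g₀.1 x) = σ (p.1 x)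
    · obtain ⟨κ, _, p', hp', hO'⟩ := exists_partition_of_isOpen hO hg₀
      obtain ⟨g, hg, hR⟩ := hμ.exists_extensionRealized hV hVμ g₀ p.2 hp' h hσ
      exact ⟨g, hO' g hg, Or.inr hR⟩
    · exact ⟨g₀, hg₀, Or.inl hσ⟩
  filter_upwards [h1, h2] with g hg1 hg2
  exact ⟨fun n p hp => hg1 n ⟨p, hp⟩, fun n m p σ f τ w hp h hσ =>
    hg2 n m ⟨p, hp⟩ σ f τ (fun k => ⟨w k, h.mem k⟩) h hσ⟩

/-- Any two generic homeomorphisms are conjugate. -/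
theorem IsGoodMeasure.isConj_of_isGenericHomeo (hμ : IsGoodMeasure μ) {g h : homeoPreserving μ}
    (hg : IsGenericHomeo μ g.1) (hh : IsGenericHomeo μ h.1) : IsConj g h := by
  have := hμ.prob
  have := hμ.fullSupport
  obtain ⟨x₀, -⟩ := nonempty_of_measure_ne_zero (μ := μ) (s := univ) (by simp)
  obtain ⟨k, -, hk, -⟩ := exists_homeo_of_backAndForth (μ := μ)
    (PartitionPair.Intertwines g.1 h.1)
    (fun P hP U hU => hP.exists_forth hg hh hU) (fun P hP U hU => hP.exists_back hg hh hU)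
    (κ := Empty) Empty.elim (fun k => k.elim)
    ⟨Unit, fun _ => (), fun _ => (), IsLocallyConstant.const _, IsLocallyConstant.const _,
      fun _ => rfl⟩
    ⟨fun _ => ⟨x₀, rfl⟩, fun _ => ⟨x₀, rfl⟩, 1, fun _ => rfl, fun _ => rfl⟩
  refine isConj_iff.2 ⟨k, mul_inv_eq_iff_eq_mul.2 (Subtype.ext (Homeomorph.ext fun x => ?_))⟩
  change k.1 (g.1 x) = h.1 (k.1 x)
  -- Were the two points distinct, a clopen set would separate them; but it is a union of pieces of
  -- an intertwined pair, on which both maps act by the same `σ`.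
  by_contra hne
  obtain ⟨U, hU, hx, hy⟩ := exists_isClopen_of_totally_separated hne
  obtain ⟨P, hP, ⟨S, rfl⟩, hPk⟩ := hk U hU
  obtain ⟨σ, hσg, hσh⟩ := hP.exists_perm
  refine hy ?_
  rw [mem_preimage, hPk, hσg] at hx
  rwa [mem_preimage, hσh, hPk]

/-- The Baire property supplies one generic element; its conjugacy class contains all the others. -/
theorem IsGoodMeasure.hasComeagerConjClass (hμ : IsGoodMeasure μ)
    (hV : QLikeSet V) (hVμ : clopenValueSet μ = V) :
    HasComeagerConjClass (homeoPreserving μ) := by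
  have := hμ.baireSpace
  have hgen := hμ.eventually_isGenericHomeo hV hVμ
  have : Nonempty (homeoPreserving μ) := ⟨1⟩
  obtain ⟨g, hg⟩ := (dense_of_mem_residual hgen).nonempty
  exact ⟨g, Filter.mem_of_superset hgen fun h hh => hμ.isConj_of_isGenericHomeo hg hh⟩

end Generic

theorem mainTheorem6 (V : Set ℝ) (hV : GroupLikeSet V) :
    (QLikeSet V ↔ AutAmalgamation.{u} V) ∧
    (QLikeSet V →
      ∀ (X : Type v) [TopologicalSpace X] [CompactSpace X] [TopologicalSpace.MetrizableSpace X]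
        [TotallyDisconnectedSpace X] [PerfectSpace X] [Nonempty X]
        [MeasurableSpace X] [BorelSpace X] (μ : Measure X),
        IsGoodMeasure μ → clopenValueSet μ = V →
          HasComeagerConjClass (homeoPreserving μ)) := by
  refine ⟨⟨fun h => h.autAmalgamation hV, fun h => h.qLikeSet hV⟩, ?_⟩
  intro hQ X _ _ _ _ _ _ _ _ μ hμ hVμ
  -- A compact metric space is second countable, as the preceding results require.
  let _ := TopologicalSpace.metrizableSpaceMetric X
  exact hμ.hasComeagerConjClass hQ hVμ
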